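/- Let $G$ be a unimodular amenable locally compact (Hausdorff) group with Haar measure $\lambda$, and let $1<p\le 2$. For measurable $g,f:G\to\mathbb C$ put $(g*f)(x)=\int_G g(y)f(y^{-1}x)\,d\lambda(y)$; we say that $g*f$ exists if $y\mapsto g(y)f(y^{-1}x)$ is $\lambda$-integrable for almost every $x\in G$. Let $L^t_p(G)$ be the set of all $f\in L^p(G)$ with $$\sup\{\|g*f\|_p : g\in C_{00}(G),\ \|g\|_p\le 1\}<\infty,$$ where $C_{00}(G)$ denotes the continuous complex-valued functions on $G$ with compact support, and let $L^T_p(G)$ be the set of all $f\in L^p(G)$ such that $g*f$ exists and belongs to $L^p(G)$ for every $g\in L^p(G)$ and $$\sup\{\|g*f\|_p : g\in L^p(G),\ \|g\|_p\le 1\}<\infty.$$ For a set $E\subseteq L^p(G)$ write $E^+$ for the set of those $f\in E$ that are real-valued and nonnegative almost everywhere. Then $$\bigl(L^1(G)\cap L^p(G)\bigr)^+=L^t_p(G)^+=L^T_p(G)^+.$$ -/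

import Mathlib

open MeasureTheory
open scoped ENNReal

noncomputable section

/-- A topological group is amenable if there is a left-invariant mean on the space of
bounded continuous real functions: a positive linear functional `m` with `m 1 = 1` that takes
the same value on `f` and on every left translate `x ↦ f (g * x)`. -/
def IsAmenableGroup (G : Type*) [Group G] [TopologicalSpace G] [IsTopologicalGroup G] : Prop :=
  ∃ m : BoundedContinuousFunction G ℝ →ₗ[ℝ] ℝ,
    (∀ f, (∀ x, 0 ≤ f x) → 0 ≤ m f) ∧
    m (BoundedContinuousFunction.const G 1) = 1 ∧
    ∀ (g : G) (f : BoundedContinuousFunction G ℝ),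
      m (f.compContinuous ⟨fun x => g * x, continuous_const_mul g⟩) = m f

section Convolution

variable {G : Type*} [Group G] [MeasurableSpace G]

/-- `f * g` exists at `x`: the integrand `y ↦ f y * g (y⁻¹ x)` is integrable. -/
def GroupConvExistsAt (μ : Measure G) (f g : G → ℂ) (x : G) : Prop :=
  Integrable (fun y => f y * g (y⁻¹ * x)) μ

/-- `f * g` exists: it exists at almost every point. -/
def GroupConvExists (μ : Measure G) (f g : G → ℂ) : Prop :=
  ∀ᵐ x ∂μ, GroupConvExistsAt μ f g x

/-- The convolution `(f * g)(x) = ∫ f y * g (y⁻¹ x) dμ(y)`. -/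
def groupConv (μ : Measure G) (f g : G → ℂ) (x : G) : ℂ :=
  ∫ y, f y * g (y⁻¹ * x) ∂μ

/-- `sup {‖g * f‖_p : g ∈ C₀₀(G), ‖g‖_p ≤ 1}`, in `[0, ∞]`. For `f ∈ L^p` and `g` continuous
with compact support, `g * f` exists at every point. -/
def temperedNorm [TopologicalSpace G] (p : ℝ≥0∞) (μ : Measure G) (f : G → ℂ) : ℝ≥0∞ :=
  ⨆ (g : G → ℂ) (_ : Continuous g) (_ : HasCompactSupport g) (_ : eLpNorm g p μ ≤ 1),
    eLpNorm (groupConv μ g f) p μ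

/-- `sup {‖g * f‖_p : g ∈ L^p(G), ‖g‖_p ≤ 1}`, in `[0, ∞]`. -/
def bigTemperedNorm (p : ℝ≥0∞) (μ : Measure G) (f : G → ℂ) : ℝ≥0∞ :=
  ⨆ (g : Lp ℂ p μ) (_ : eLpNorm g p μ ≤ 1), eLpNorm (groupConv μ g f) p μ

/-- `L^t_p(G)`: the `p`-tempered functions. -/
def LtSpace [TopologicalSpace G] (p : ℝ≥0∞) (μ : Measure G) : Set (Lp ℂ p μ) :=
  {f | temperedNorm p μ f < ∞}

/-- `L^T_p(G)`: the functions `f ∈ L^p(G)` such that `g * f` exists and belongs to `L^p(G)` for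
all `g ∈ L^p(G)`, with `sup {‖g * f‖_p : g ∈ L^p(G), ‖g‖_p ≤ 1} < ∞`. -/
def LTSpace (p : ℝ≥0∞) (μ : Measure G) : Set (Lp ℂ p μ) :=
  {f | (∀ g : Lp ℂ p μ, GroupConvExists μ g f ∧ MemLp (groupConv μ g f) p μ) ∧
    bigTemperedNorm p μ f < ∞}

/-- `L^1(G) ∩ L^p(G)`, as a subset of `L^p(G)`. -/
def L1InterLp (p : ℝ≥0∞) (μ : Measure G) : Set (Lp ℂ p μ) :=
  {f | MemLp f 1 μ}

/-- The positive part `E⁺` of a set `E ⊆ L^p(G)`: the classes in `E` of functions that are almost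
everywhere real and nonnegative. -/
def positivePart {p : ℝ≥0∞} {μ : Measure G} (E : Set (Lp ℂ p μ)) : Set (Lp ℂ p μ) :=
  {f | f ∈ E ∧ ∀ᵐ x ∂μ, 0 ≤ (f x).re ∧ (f x).im = 0}

end Convolution

end

open Set Filter Topology
open scoped Pointwise

set_option linter.unusedSectionVars false

/-! ### Convolution of compactly supported real functions: associativity, adjoints, Jensen and
Young. -/

section RealConvolution

variable {G : Type*} [Group G] [TopologicalSpace G] [IsTopologicalGroup G]
  [MeasurableSpace G]

/-! Young's inequality `‖g * f‖ₚ ≤ ‖g‖ₚ ‖f‖₁`, valid because `G` is unimodular, puts `L¹ ∩ Lᵖ`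
inside `LTSpace`, and `LTSpace ⊆ LtSpace` is immediate. The substance is that a nonnegative tempered
`f` is integrable.

This rests on a lower bound: on an amenable group, right convolution by a nonnegative `v` in
`C₀₀(G)` has norm at least `∫ v` on `Lᵖ` (`IsAmenableGroup.integral_le_of_convBound`). Granted that,
truncate `f` to the set where `|f| ≥ 1/(n+1)`. The truncation is in `L¹`, convolves no larger than
`f` does because everything is nonnegative, and is within `1` in `L¹` of some such `v`. Hence its
`L¹` norm is at most the tempered norm plus `2`, uniformly in `n`, and Fatou's lemma finishes.

For the lower bound, Jensen's inequality with exponent `2/p ≥ 1` reduces `p` to `2`, and adding the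
adjoint reduces to symmetric `v`. The symmetric case is Kesten's theorem. If the `L²` norm is at
most `r < ρ`, the resolvent `h = ∑ ρ⁻ⁿ v⁽ⁿ⁾` converges and satisfies `h * v ≤ ρ h`. Averaging the
ratios `h (x * y) / h x` over `x` with the invariant mean, and using `q + q⁻¹ ≥ 2` to pair `y` with
`y⁻¹`, gives `∫ v ≤ ρ`. A Harnack inequality for `h` makes these ratios bounded in `x` and norm
continuous in `y`, so that the mean can be exchanged with the integral. -/

/-- The convolution of two real functions on a group. -/
noncomputable def realConv (μ : Measure G) (f g : G → ℝ) (x : G) : ℝ :=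
  ∫ y, f y * g (y⁻¹ * x) ∂μ

/-- Continuous real functions with compact support. -/
structure IsCc (f : G → ℝ) : Prop where
  continuous : Continuous f
  compact : HasCompactSupport f

namespace IsCc

variable {f g k : G → ℝ}

theorem mul_inv_mul (hf : IsCc f) (hg : Continuous g) (x : G) :
    IsCc fun y => f y * g (y⁻¹ * x) :=
  ⟨hf.continuous.mul (hg.comp (by fun_prop)), hf.compact.mul_right⟩

theorem comp_inv (hf : IsCc f) : IsCc fun x => f x⁻¹ :=
  ⟨hf.continuous.comp continuous_inv, hf.compact.comp_homeomorph (Homeomorph.inv G)⟩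

theorem comp_mul_right (hf : IsCc f) (a : G) : IsCc fun x => f (x * a) :=
  ⟨hf.continuous.comp (continuous_mul_const a), hf.compact.comp_homeomorph (Homeomorph.mulRight a)⟩

theorem comp_mul_left (hf : IsCc f) (a : G) : IsCc fun x => f (a * x) :=
  ⟨hf.continuous.comp (continuous_const_mul a), hf.compact.comp_homeomorph (Homeomorph.mulLeft a)⟩

theorem mul (hf : IsCc f) (hg : Continuous g) : IsCc fun x => f x * g x :=
  ⟨hf.continuous.mul hg, hf.compact.mul_right⟩

theorem const_mul (c : ℝ) (hf : IsCc f) : IsCc fun x => c * f x :=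
  ⟨continuous_const.mul hf.continuous, hf.compact.mul_left⟩

theorem add (hf : IsCc f) (hg : IsCc g) : IsCc fun x => f x + g x :=
  ⟨hf.continuous.add hg.continuous, hf.compact.add hg.compact⟩

theorem sub (hf : IsCc f) (hg : IsCc g) : IsCc fun x => f x - g x :=
  ⟨hf.continuous.sub hg.continuous, hf.compact.sub hg.compact⟩

theorem rpow (hf : IsCc f) {s : ℝ} (hs : 0 < s) : IsCc fun x => f x ^ s :=
  ⟨hf.continuous.rpow_const fun _ => Or.inr hs.le,
    hf.compact.comp_left (g := fun t : ℝ => t ^ s) (Real.zero_rpow hs.ne')⟩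

theorem sq (hf : IsCc f) : IsCc fun x => f x ^ 2 :=
  ⟨hf.continuous.pow 2, hf.compact.comp_left (g := fun t : ℝ => t ^ 2) (by simp)⟩

theorem uncurry_mul (hf : IsCc f) (hg : IsCc g) :
    Continuous (Function.uncurry fun y x => f y * g (y⁻¹ * x)) ∧
      HasCompactSupport (Function.uncurry fun y x => f y * g (y⁻¹ * x)) := by
  constructor
  · exact (hf.continuous.comp continuous_fst).mul (hg.continuous.comp (by fun_prop))
  · refine HasCompactSupport.of_support_subset_isCompact
      (hf.compact.prod (hf.compact.mul hg.compact)) ?_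
    rintro ⟨y, x⟩ h
    simp only [Function.uncurry, Function.mem_support] at h
    have h1 : y ∈ tsupport f := subset_closure (left_ne_zero_of_mul h)
    exact ⟨h1, ⟨y, h1, y⁻¹ * x, subset_closure (right_ne_zero_of_mul h), by simp⟩⟩

variable [BorelSpace G] {μ : Measure G} [IsFiniteMeasureOnCompacts μ]

theorem integrable (hf : IsCc f) : Integrable f μ :=
  hf.continuous.integrable_of_hasCompactSupport hf.compact

theorem memLp (hf : IsCc f) (p : ℝ≥0∞) : MemLp f p μ :=
  hf.continuous.memLp_of_hasCompactSupport hf.compact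

theorem realConv [T2Space G] (hf : IsCc f) (hg : IsCc g) : IsCc (realConv μ f g) := by
  constructor
  · rw [← continuousOn_univ]
    refine continuousOn_integral_of_compact_support (k := tsupport f) hf.compact ?_ ?_
    · exact Continuous.continuousOn ((hf.continuous.comp continuous_snd).mul
        (hg.continuous.comp (by fun_prop)))
    · intro p x _ hx
      simp [image_eq_zero_of_notMem_tsupport hx]
  · refine HasCompactSupport.of_support_subset_isCompact (hf.compact.mul hg.compact) ?_
    intro x hx
    by_contra hc
    refine hx ?_
    have : ∀ y, f y * g (y⁻¹ * x) = 0 := by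
      intro y
      by_contra h
      exact hc ⟨y, subset_closure (left_ne_zero_of_mul h), y⁻¹ * x,
        subset_closure (right_ne_zero_of_mul h), by simp⟩
    simp [_root_.realConv, this]

end IsCc

variable {μ : Measure G} {f g k : G → ℝ}

theorem realConv_nonneg (hf : ∀ x, 0 ≤ f x) (hg : ∀ x, 0 ≤ g x) (x : G) : 0 ≤ realConv μ f g x :=
  integral_nonneg fun _ => mul_nonneg (hf _) (hg _)

theorem realConv_add_right [BorelSpace G] [IsFiniteMeasureOnCompacts μ]
    (hf : IsCc f) (hg : Continuous g) (hk : Continuous k) (x : G) :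
    realConv μ f (fun y => g y + k y) x = realConv μ f g x + realConv μ f k x := by
  simp only [realConv, mul_add]
  exact integral_add (hf.mul_inv_mul hg x).integrable (hf.mul_inv_mul hk x).integrable

theorem realConv_sub_right [BorelSpace G] [IsFiniteMeasureOnCompacts μ]
    (hf : IsCc f) (hg : Continuous g) (hk : Continuous k) (x : G) :
    realConv μ f (fun y => g y - k y) x = realConv μ f g x - realConv μ f k x := by
  simp only [realConv, mul_sub]
  exact integral_sub (hf.mul_inv_mul hg x).integrable (hf.mul_inv_mul hk x).integrable

theorem realConv_const_mul_right (c : ℝ) (x : G) :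
    realConv μ f (fun y => c * g y) x = c * realConv μ f g x := by
  simp only [realConv, ← integral_const_mul]
  congr 1; ext y; ring

theorem realConv_mono_right [BorelSpace G] [IsFiniteMeasureOnCompacts μ]
    (hf : IsCc f) (hf0 : ∀ x, 0 ≤ f x) (hg : Continuous g) (hk : Continuous k)
    (h : ∀ x, g x ≤ k x) (x : G) : realConv μ f g x ≤ realConv μ f k x :=
  integral_mono (hf.mul_inv_mul hg x).integrable (hf.mul_inv_mul hk x).integrable
    fun _ => mul_le_mul_of_nonneg_left (h _) (hf0 _)

theorem realConv_comp_mul_right (a x : G) :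
    realConv μ f (fun y => g (y * a)) x = realConv μ f g (x * a) := by
  simp only [realConv, mul_assoc]

theorem realConv_pos [BorelSpace G] [IsFiniteMeasureOnCompacts μ] [μ.IsOpenPosMeasure]
    (hf : IsCc f) (hg : Continuous g) (hf0 : ∀ x, 0 ≤ f x) (hg0 : ∀ x, 0 ≤ g x) {x y : G}
    (hx : 0 < f x) (hy : 0 < g y) : 0 < realConv μ f g (x * y) := by
  have h := hf.mul_inv_mul hg (x * y)
  refine h.continuous.integral_pos_of_hasCompactSupport_nonneg_nonzero h.compact
    (fun _ => mul_nonneg (hf0 _) (hg0 _)) (x := x) ?_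
  simpa using ⟨hx.ne', hy.ne'⟩

section Invariant

variable [BorelSpace G] [IsFiniteMeasureOnCompacts μ] [μ.IsMulLeftInvariant] [μ.IsInvInvariant]

theorem integral_inv_mul_eq [μ.IsMulRightInvariant] {E : Type*} [NormedAddCommGroup E]
    [NormedSpace ℝ E] (g : G → E) (x : G) : ∫ y, g (y⁻¹ * x) ∂μ = ∫ y, g y ∂μ := by
  rw [integral_inv_eq_self (fun y => g (y * x)) μ, integral_mul_right_eq_self]

theorem integral_realConv (hf : IsCc f) (hg : IsCc g) :
    ∫ x, realConv μ f g x ∂μ = (∫ x, f x ∂μ) * ∫ x, g x ∂μ := by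
  simp only [realConv]
  rw [← integral_integral_swap_of_hasCompactSupport (hf.uncurry_mul hg).1 (hf.uncurry_mul hg).2]
  simp_rw [integral_const_mul, integral_mul_left_eq_self g]
  rw [integral_mul_const]

theorem realConv_assoc (hf : IsCc f) (hg : IsCc g) (hk : IsCc k) (x : G) :
    realConv μ (realConv μ f g) k x = realConv μ f (realConv μ g k) x := by
  have hc : Continuous (Function.uncurry fun y z => f y * g (y⁻¹ * z) * k (z⁻¹ * x)) :=
    (hf.uncurry_mul hg).1.mul (hk.continuous.comp (by fun_prop))
  have hs : HasCompactSupport (Function.uncurry fun y z => f y * g (y⁻¹ * z) * k (z⁻¹ * x)) :=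
    (hf.uncurry_mul hg).2.mul_right
  simp only [realConv]
  calc ∫ z, (∫ y, f y * g (y⁻¹ * z) ∂μ) * k (z⁻¹ * x) ∂μ
      = ∫ z, ∫ y, f y * g (y⁻¹ * z) * k (z⁻¹ * x) ∂μ ∂μ := by simp_rw [integral_mul_const]
    _ = ∫ y, ∫ z, f y * g (y⁻¹ * z) * k (z⁻¹ * x) ∂μ ∂μ :=
        (integral_integral_swap_of_hasCompactSupport hc hs).symm
    _ = ∫ y, f y * ∫ z, g z * k (z⁻¹ * (y⁻¹ * x)) ∂μ ∂μ := by
        congr 1; ext y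
        rw [← integral_const_mul, ← integral_mul_left_eq_self _ y]
        congr 1; ext z
        simp [mul_assoc]

/-- Fubini. It identifies the adjoint of right convolution by `g`, and so lets a non-symmetric
kernel be symmetrized. -/
theorem integral_realConv_mul (hf : IsCc f) (hg : IsCc g) (hk : IsCc k) :
    ∫ x, realConv μ f g x * k x ∂μ = ∫ x, f x * realConv μ k (fun y => g y⁻¹) x ∂μ := by
  have hc : Continuous (Function.uncurry fun y x => f y * g (y⁻¹ * x) * k x) :=
    (hf.uncurry_mul hg).1.mul (hk.continuous.comp continuous_snd)
  have hs : HasCompactSupport (Function.uncurry fun y x => f y * g (y⁻¹ * x) * k x) :=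
    (hf.uncurry_mul hg).2.mul_right
  simp only [realConv]
  simp_rw [← integral_mul_const, ← integral_const_mul]
  rw [← integral_integral_swap_of_hasCompactSupport hc hs]
  congr 1; ext y; congr 1; ext x
  simp only [mul_inv_rev, inv_inv]
  ring

theorem realConv_inv (x : G) : realConv μ f g x⁻¹ =
    realConv μ (fun y => g y⁻¹) (fun y => f y⁻¹) x := by
  simp only [realConv]
  rw [← integral_mul_left_eq_self (fun y => g y⁻¹ * f (y⁻¹ * x)⁻¹) x]
  simp [mul_comm]

/-- Jensen's inequality for the convolution with a nonnegative function. -/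
theorem realConv_rpow_le [μ.IsMulRightInvariant] (hf : IsCc f) (hg : IsCc g) (hf0 : ∀ x, 0 ≤ f x)
    (hg0 : ∀ x, 0 ≤ g x) {s : ℝ} (hs : 1 ≤ s) (x : G) :
    realConv μ f g x ^ s ≤ realConv μ (fun y => f y ^ s) g x * (∫ y, g y ∂μ) ^ (s - 1) := by
  have hs0 : 0 < s := by linarith
  have hM0 : 0 ≤ ∫ y, g y ∂μ := integral_nonneg hg0
  have hI : ∫ y, g (y⁻¹ * x) ∂μ = ∫ y, g y ∂μ := integral_inv_mul_eq g x
  have hgi : Integrable (fun y => g (y⁻¹ * x)) μ :=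
    ((hg.comp_mul_right x).comp_inv).integrable
  have hA0 : 0 ≤ realConv μ f g x := realConv_nonneg hf0 hg0 x
  have hB0 : 0 ≤ realConv μ (fun y => f y ^ s) g x :=
    realConv_nonneg (fun y => Real.rpow_nonneg (hf0 y) s) hg0 x
  set M := ∫ y, g y ∂μ with hM
  set A := realConv μ f g x with hA
  rcases hA0.eq_or_lt with h0 | hApos
  · rw [← h0, Real.zero_rpow hs0.ne']
    positivity
  have hMpos : 0 < M := by
    refine hM0.lt_of_ne fun h => hApos.ne' ?_
    have := (integral_eq_zero_iff_of_nonneg (fun y => hg0 (y⁻¹ * x)) hgi).1 (hI.trans h.symm)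
    rw [hA, realConv]
    refine (integral_congr_ae ?_).trans (integral_zero G ℝ)
    filter_upwards [this] with y hy
    simp only [Pi.zero_apply] at hy
    rw [hy, mul_zero]
  -- `a` is the mean of `f` for the probability weight `g (y⁻¹ * x) / M`. Bernoulli's inequality
  -- gives the tangent line to `t ^ s` at `a`; its linear part integrates to zero against the
  -- weight.
  set a := A / M with ha
  have ha0 : 0 < a := by positivity
  have key : ∀ t : ℝ, 0 ≤ t → a ^ s + s * a ^ (s - 1) * (t - a) ≤ t ^ s := by
    intro t ht
    have h1 := one_add_mul_self_le_rpow_one_add (s := t / a - 1) (p := s)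
      (by have : 0 ≤ t / a := by positivity
          linarith) hs
    have h2 : a ^ s * (1 + s * (t / a - 1)) ≤ a ^ s * (1 + (t / a - 1)) ^ s := by gcongr
    have h3 : a ^ s * (1 + (t / a - 1)) ^ s = t ^ s := by
      rw [add_sub_cancel, ← Real.mul_rpow ha0.le (by positivity), mul_div_cancel₀ _ ha0.ne']
    have h4 : a ^ s * (1 + s * (t / a - 1)) = a ^ s + s * a ^ (s - 1) * (t - a) := by
      rw [Real.rpow_sub_one ha0.ne']
      field_simp
    linarith
  have hint : ∫ y, (a ^ s * g (y⁻¹ * x) + s * a ^ (s - 1) *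
      (f y * g (y⁻¹ * x) - a * g (y⁻¹ * x))) ∂μ ≤ realConv μ (fun y => f y ^ s) g x := by
    refine integral_mono ?_ ((hf.rpow hs0).mul_inv_mul hg.continuous x).integrable ?_
    · exact (hgi.const_mul _).add ((((hf.mul_inv_mul hg.continuous x).integrable).sub
        (hgi.const_mul _)).const_mul _)
    · intro y
      have := mul_le_mul_of_nonneg_right (key (f y) (hf0 y)) (hg0 (y⁻¹ * x))
      simp only
      linarith
  have hAeq : ∫ y, f y * g (y⁻¹ * x) ∂μ = A := rfl
  have heq : ∫ y, (a ^ s * g (y⁻¹ * x) + s * a ^ (s - 1) *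
      (f y * g (y⁻¹ * x) - a * g (y⁻¹ * x))) ∂μ = a ^ s * M := by
    have h1 := hgi.const_mul a
    have h2 := (hf.mul_inv_mul hg.continuous x).integrable (μ := μ)
    have h3 : A - a * M = 0 := by rw [ha]; field_simp; ring
    have h4 : Integrable (fun y => f y * g (y⁻¹ * x) - a * g (y⁻¹ * x)) μ := h2.sub h1
    rw [integral_add (hgi.const_mul _) (h4.const_mul _), integral_const_mul,
      integral_const_mul, integral_sub h2 h1, integral_const_mul, hI, hAeq, h3, mul_zero, add_zero]
  rw [heq] at hint
  calc A ^ s = a ^ s * M * M ^ (s - 1) := by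
        rw [ha, Real.div_rpow hA0 hM0, Real.rpow_sub_one hMpos.ne']
        have := (Real.rpow_pos_of_pos hMpos s).ne'
        field_simp
    _ ≤ _ := by gcongr

/-- Young's inequality for continuous functions with compact support. -/
theorem integral_realConv_rpow_le [T2Space G] [μ.IsMulRightInvariant] (hf : IsCc f) (hg : IsCc g)
    (hf0 : ∀ x, 0 ≤ f x) (hg0 : ∀ x, 0 ≤ g x) {s : ℝ} (hs : 1 ≤ s) :
    ∫ x, realConv μ f g x ^ s ∂μ ≤ (∫ x, f x ^ s ∂μ) * (∫ x, g x ∂μ) ^ s := by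
  have hs0 : 0 < s := by linarith
  have hM0 : 0 ≤ ∫ y, g y ∂μ := integral_nonneg hg0
  calc ∫ x, realConv μ f g x ^ s ∂μ
      ≤ ∫ x, realConv μ (fun y => f y ^ s) g x * (∫ y, g y ∂μ) ^ (s - 1) ∂μ :=
        integral_mono ((hf.realConv hg).rpow hs0).integrable
          (((hf.rpow hs0).realConv hg).integrable.mul_const _)
          fun x => realConv_rpow_le hf hg hf0 hg0 hs x
    _ = (∫ x, f x ^ s ∂μ) * ((∫ x, g x ∂μ) * (∫ x, g x ∂μ) ^ (s - 1)) := by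
        rw [integral_mul_const, integral_realConv (hf.rpow hs0) hg, mul_assoc]
    _ = _ := by
        congr 1
        rcases hM0.eq_or_lt with h | h
        · rw [← h, zero_mul, Real.zero_rpow hs0.ne']
        · rw [Real.rpow_sub_one h.ne']
          field_simp

end Invariant

end RealConvolution

/-! ### Invariant means and the mass of a kernel with a positive superharmonic function. -/

section Amenable

variable {G : Type*} [Group G] [TopologicalSpace G] [IsTopologicalGroup G]

/-- Positivity and normalization force norm at most one; continuity is what lets the mean commute
with Bochner integrals. -/
theorem IsAmenableGroup.exists_continuous_mean (hG : IsAmenableGroup G) :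
    ∃ m : BoundedContinuousFunction G ℝ →L[ℝ] ℝ,
      (∀ f g : BoundedContinuousFunction G ℝ, (∀ x, f x ≤ g x) → m f ≤ m g) ∧
      (∀ c, m (BoundedContinuousFunction.const G c) = c) ∧
      ∀ (a : G) (f g : BoundedContinuousFunction G ℝ), (∀ x, f (a * x) = g x) → m f = m g := by
  obtain ⟨m, hpos, hone, hinv⟩ := hG
  have hmono : ∀ f g : BoundedContinuousFunction G ℝ, (∀ x, f x ≤ g x) → m f ≤ m g := by
    intro f g h
    have := hpos (g - f) (fun x => by simpa using h x)
    rw [map_sub] at this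
    linarith
  have hconst : ∀ c, m (BoundedContinuousFunction.const G c) = c := by
    intro c
    have : BoundedContinuousFunction.const G c = c • BoundedContinuousFunction.const G (1 : ℝ) := by
      ext; simp
    rw [this, map_smul, hone, smul_eq_mul, mul_one]
  refine ⟨m.mkContinuous 1 fun f => ?_, hmono, hconst, ?_⟩
  · rw [one_mul, Real.norm_eq_abs, abs_le]
    constructor
    · rw [← hconst (-‖f‖)]
      exact hmono _ _ fun x => (abs_le.1 (f.norm_coe_le_norm x)).1
    · rw [← hconst ‖f‖]
      exact hmono _ _ fun x => (abs_le.1 (f.norm_coe_le_norm x)).2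
  · intro a f g h
    have := hinv a f
    have h2 : f.compContinuous ⟨fun x => a * x, continuous_const_mul a⟩ = g := by
      ext x; exact h x
    rw [h2] at this
    exact this.symm

/-- A continuous map onto an open subgroup, equivariant for the action `y • x = x * y⁻¹`. -/
theorem Subgroup.exists_continuous_equivariant (H : Subgroup G) (hH : IsOpen (H : Set G)) :
    ∃ σ : G → G, Continuous σ ∧ (∀ x, σ x ∈ H) ∧ ∀ x, ∀ y ∈ H, σ (y * x) = σ x * y⁻¹ := by
  have : DiscreteTopology (G ⧸ H) := QuotientGroup.discreteTopology hH
  -- The coset `x⁻¹H` does not change when `x` becomes `y * x` with `y ∈ H`, so only the factor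
  -- `x⁻¹` moves. Since `G ⧸ H` is discrete, choosing representatives is continuous.
  refine ⟨fun x => (Quotient.out (((x⁻¹ : G)) : G ⧸ H))⁻¹ * x⁻¹, ?_, ?_, ?_⟩
  · refine Continuous.mul (Continuous.inv ?_) continuous_inv
    exact continuous_of_discreteTopology.comp (QuotientGroup.continuous_mk.comp continuous_inv)
  · intro x
    rw [← QuotientGroup.eq]
    exact QuotientGroup.out_eq' _
  · intro x y hy
    have : (((y * x)⁻¹ : G) : G ⧸ H) = ((x⁻¹ : G) : G ⧸ H) := by
      rw [QuotientGroup.eq]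
      simpa using hy
    simp only
    rw [this]
    simp [mul_assoc]

variable [MeasurableSpace G] [BorelSpace G] {μ : Measure G} [IsFiniteMeasureOnCompacts μ]
  [μ.IsInvInvariant]

/-- On an amenable group, a symmetric kernel `v` admitting a positive function `h` with
`∫ h (x * y) * v y ≤ ρ * h x`, subject to a Harnack inequality, has mass at most `ρ`. -/
theorem IsAmenableGroup.integral_le_of_superharmonic (hG : IsAmenableGroup G) (H : Subgroup G)
    (hH : IsOpen (H : Set G)) {v h : G → ℝ} {ρ : ℝ} (hv : IsCc v) (hv0 : ∀ x, 0 ≤ v x)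
    (hvs : ∀ x, v x⁻¹ = v x) (hvH : ∀ x, v x ≠ 0 → x ∈ H) (hc : Continuous h)
    (hpos : ∀ x ∈ H, 0 < h x) (hbd : ∀ y ∈ H, ∃ C, ∀ x ∈ H, h (x * y) ≤ C * h x)
    (hcont : ∀ y ∈ H, ∀ ε > 0, ∀ᶠ z in 𝓝 y, ∀ x ∈ H, |h (x * z) - h (x * y)| ≤ ε * h x)
    (hρ : ∀ x ∈ H, ∫ y, h (x * y) * v y ∂μ ≤ ρ * h x) : ∫ x, v x ∂μ ≤ ρ := by
  obtain ⟨m, hmono, hconst, hinv⟩ := hG.exists_continuous_mean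
  obtain ⟨σ, hσc, hσH, hσ⟩ := H.exists_continuous_equivariant hH
  -- Pulling back along `σ` turns ratios on `H`, where `h` is positive, into functions on all of
  -- `G`, so the mean of `G` can be used directly.
  have hq : ∀ y ∈ H, ∃ q : BoundedContinuousFunction G ℝ, ∀ x, q x = h (σ x * y) / h (σ x) := by
    intro y hy
    obtain ⟨C, hC⟩ := hbd y hy
    refine ⟨BoundedContinuousFunction.ofNormedAddCommGroup (fun x => h (σ x * y) / h (σ x))
      ?_ C ?_, fun x => rfl⟩
    · exact (hc.comp (hσc.mul continuous_const)).div (hc.comp hσc) fun x => (hpos _ (hσH x)).ne'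
    · intro x
      have h1 := hpos _ (hσH x)
      have h2 := hpos _ (H.mul_mem (hσH x) hy)
      rw [Real.norm_of_nonneg (by positivity), div_le_iff₀ h1]
      exact hC _ (hσH x)
  -- Off `H` the value of `q` is arbitrary, which is harmless because `v` vanishes there.
  choose! q hq using hq
  have hq0 : ∀ y ∈ H, ∀ x, 0 < q y x := by
    intro y hy x
    rw [hq y hy]
    exact div_pos (hpos _ (H.mul_mem (hσH x) hy)) (hpos _ (hσH x))
  -- Translating `q y⁻¹` by `y⁻¹` gives the pointwise inverse of `q y`, so this is `q + q⁻¹ ≥ 2`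
  -- under the mean.
  have hsum : ∀ y ∈ H, 2 ≤ m (q y) + m (q y⁻¹) := by
    intro y hy
    have hy' := H.inv_mem hy
    let g : BoundedContinuousFunction G ℝ :=
      (q y⁻¹).compContinuous ⟨fun x => y⁻¹ * x, continuous_const_mul _⟩
    have hg : ∀ x, g x = (q y x)⁻¹ := by
      intro x
      change q y⁻¹ (y⁻¹ * x) = _
      rw [hq _ hy', hq _ hy, hσ _ _ hy']
      simp
    rw [hinv y⁻¹ (q y⁻¹) g (fun x => rfl), ← map_add, ← hconst 2]
    refine hmono _ _ fun x => ?_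
    have h0 := hq0 y hy x
    simp only [BoundedContinuousFunction.const_apply, BoundedContinuousFunction.add_apply, hg]
    have h1 : q y x + (q y x)⁻¹ - 2 = (q y x - 1) ^ 2 / q y x := by field_simp; ring
    have h2 : 0 ≤ (q y x - 1) ^ 2 / q y x := by positivity
    linarith
  let F : G → BoundedContinuousFunction G ℝ := fun y => v y • q y
  have hHc : IsClosed (H : Set G) := H.isClosed_of_isOpen hH
  have hFc : Continuous F := by
    rw [continuous_iff_continuousAt]
    intro y
    by_cases hy : y ∈ H
    · refine hv.continuous.continuousAt.smul ?_
      rw [Metric.continuousAt_iff']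
      intro ε hε
      filter_upwards [hcont y hy (ε / 2) (by positivity), hH.mem_nhds hy] with z hz hzH
      refine lt_of_le_of_lt ?_ (half_lt_self hε)
      rw [BoundedContinuousFunction.dist_le (by positivity)]
      intro x
      have h1 := hpos _ (hσH x)
      rw [hq z hzH, hq y hy, Real.dist_eq, ← sub_div, abs_div, abs_of_pos h1, div_le_iff₀ h1]
      exact hz _ (hσH x)
    · have : F =ᶠ[𝓝 y] fun _ => 0 := by
        filter_upwards [hHc.isOpen_compl.mem_nhds hy] with z hz
        have : v z = 0 := by
          by_contra hne
          exact hz (hvH z hne)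
        simp [F, this]
      exact continuousAt_const.congr this.symm
  have hFs : HasCompactSupport F := hv.compact.smul_right
  have hFi : Integrable F μ := hFc.integrable_of_hasCompactSupport hFs
  have hmF : Integrable (fun y => m (F y)) μ := m.integrable_comp hFi
  have hmI : m (∫ y, F y ∂μ) = ∫ y, m (F y) ∂μ := (m.integral_comp_comm hFi).symm
  have hle : m (∫ y, F y ∂μ) ≤ ρ := by
    rw [← hconst ρ]
    refine hmono _ _ fun x => ?_
    have h1 := hpos _ (hσH x)
    have h2 : (∫ y, F y ∂μ) x = ∫ y, F y x ∂μ :=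
      ((BoundedContinuousFunction.evalCLM ℝ x).integral_comp_comm hFi).symm
    have h3 : ∀ y, F y x = (h (σ x * y) * v y) * (h (σ x))⁻¹ := by
      intro y
      by_cases hy : v y = 0
      · simp [F, hy]
      · simp only [F, BoundedContinuousFunction.smul_apply, smul_eq_mul, hq y (hvH y hy)]
        ring
    simp_rw [h2, h3, integral_mul_const, BoundedContinuousFunction.const_apply]
    rw [← div_eq_mul_inv, div_le_iff₀ h1]
    exact hρ _ (hσH x)
  have hinvI : ∫ y, m (F y⁻¹) ∂μ = ∫ y, m (F y) ∂μ := integral_inv_eq_self (fun y => m (F y)) μ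
  have h2 : ∫ y, 2 * v y ∂μ ≤ ∫ y, (m (F y) + m (F y⁻¹)) ∂μ := by
    refine integral_mono (hv.integrable.const_mul 2) (hmF.add hmF.comp_inv) fun y => ?_
    by_cases hy : v y = 0
    · simp [F, hvs, hy]
    · simp only [F, map_smul, smul_eq_mul, hvs, ← mul_add]
      rw [mul_comm]
      exact mul_le_mul_of_nonneg_left (hsum y (hvH y hy)) (hv0 y)
  rw [integral_const_mul, integral_add hmF hmF.comp_inv, hinvI, ← hmI] at h2
  linarith

end Amenable

/-! ### Convolution powers, the resolvent and Kesten's theorem. -/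

section ConvolutionPowers

variable {G : Type*} [Group G] [TopologicalSpace G] [IsTopologicalGroup G]
  [MeasurableSpace G]

/-- The convolution powers of `v`, starting from `convPow μ v 0 = v`. -/
noncomputable def convPow (μ : Measure G) (v : G → ℝ) : ℕ → G → ℝ
  | 0 => v
  | n + 1 => realConv μ (convPow μ v n) v

variable {μ : Measure G} {v f g : G → ℝ}

theorem convPow_nonneg (hv0 : ∀ x, 0 ≤ v x) (n : ℕ) (x : G) : 0 ≤ convPow μ v n x := by
  induction n generalizing x with
  | zero => exact hv0 x
  | succ n ih => exact realConv_nonneg ih hv0 x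

variable [BorelSpace G] [IsFiniteMeasureOnCompacts μ]

theorem integral_mul_le_sqrt_mul_sqrt (hf : IsCc f) (hg : IsCc g) (hf0 : ∀ x, 0 ≤ f x)
    (hg0 : ∀ x, 0 ≤ g x) :
    ∫ x, f x * g x ∂μ ≤ √(∫ x, f x ^ 2 ∂μ) * √(∫ x, g x ^ 2 ∂μ) := by
  have := integral_mul_le_Lp_mul_Lq_of_nonneg (μ := μ) Real.HolderConjugate.two_two
    (Eventually.of_forall hf0) (Eventually.of_forall hg0) (hf.memLp _) (hg.memLp _)
  simpa [Real.sqrt_eq_rpow] using this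

variable [T2Space G]

theorem IsCc.convPow (hv : IsCc v) (n : ℕ) : IsCc (convPow μ v n) := by
  induction n with
  | zero => exact hv
  | succ n ih => exact ih.realConv hv

variable [μ.IsMulLeftInvariant] [μ.IsInvInvariant]

theorem realConv_convPow (hv : IsCc v) (n k : ℕ) :
    realConv μ (convPow μ v n) (convPow μ v k) = convPow μ v (n + k + 1) := by
  induction k with
  | zero => rfl
  | succ k ih =>
    ext x
    rw [convPow, ← realConv_assoc (hv.convPow n) (hv.convPow k) hv, ih]
    rfl

theorem convPow_inv (hv : IsCc v) (hvs : ∀ x, v x⁻¹ = v x) (n : ℕ) (x : G) :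
    convPow μ v n x⁻¹ = convPow μ v n x := by
  induction n generalizing x with
  | zero => exact hvs x
  | succ n ih =>
    rw [convPow, realConv_inv]
    simp only [ih, hvs]
    have := realConv_convPow (μ := μ) hv 0 n
    rw [zero_add] at this
    exact congrFun this x

variable [μ.IsMulRightInvariant]

theorem integral_convPow_sq_le (hv : IsCc v) (hv0 : ∀ x, 0 ≤ v x) {r : ℝ}
    (hr : ∀ g, IsCc g → (∀ x, 0 ≤ g x) →
      ∫ x, realConv μ g v x ^ 2 ∂μ ≤ r ^ 2 * ∫ x, g x ^ 2 ∂μ) (n : ℕ) :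
    ∫ x, convPow μ v n x ^ 2 ∂μ ≤ (r ^ n) ^ 2 * ∫ x, v x ^ 2 ∂μ := by
  induction n with
  | zero => simp [convPow]
  | succ n ih =>
    refine (hr _ (hv.convPow n) (convPow_nonneg hv0 n)).trans ?_
    calc r ^ 2 * ∫ x, convPow μ v n x ^ 2 ∂μ ≤ r ^ 2 * ((r ^ n) ^ 2 * ∫ x, v x ^ 2 ∂μ) := by gcongr
      _ = _ := by ring

/-- One convolution by `v` turns the `L²` decay of the powers into a uniform bound, by
Cauchy–Schwarz. This makes the resolvent converge for `t < r⁻¹`. -/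
theorem exists_convPow_le (hv : IsCc v) (hv0 : ∀ x, 0 ≤ v x) {r : ℝ} (hr0 : 0 < r)
    (hr : ∀ g, IsCc g → (∀ x, 0 ≤ g x) →
      ∫ x, realConv μ g v x ^ 2 ∂μ ≤ r ^ 2 * ∫ x, g x ^ 2 ∂μ) :
    ∃ B, ∀ n x, convPow μ v n x ≤ B * r ^ n := by
  obtain ⟨B, hB⟩ := hv.continuous.bounded_above_of_compact_support hv.compact
  set A := ∫ x, v x ^ 2 ∂μ with hA
  have hA0 : 0 ≤ A := integral_nonneg fun x => sq_nonneg _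
  refine ⟨max B (A / r), fun n x => ?_⟩
  cases n with
  | zero =>
    rw [pow_zero, mul_one]
    exact ((le_abs_self _).trans (hB x)).trans (le_max_left _ _)
  | succ n =>
    have h1 : convPow μ v (n + 1) x ≤
        √(∫ y, convPow μ v n y ^ 2 ∂μ) * √(∫ y, v (y⁻¹ * x) ^ 2 ∂μ) :=
      integral_mul_le_sqrt_mul_sqrt (hv.convPow n) ((hv.comp_mul_right x).comp_inv)
        (convPow_nonneg hv0 n) (fun y => hv0 _)
    rw [integral_inv_mul_eq (fun y => v y ^ 2) x, ← hA] at h1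
    have h2 : √(∫ y, convPow μ v n y ^ 2 ∂μ) ≤ r ^ n * √A := by
      refine (Real.sqrt_le_sqrt (integral_convPow_sq_le hv hv0 hr n)).trans_eq ?_
      rw [Real.sqrt_mul (sq_nonneg _), Real.sqrt_sq (by positivity)]
    calc convPow μ v (n + 1) x ≤ r ^ n * √A * √A := h1.trans (by gcongr)
      _ = A / r * r ^ (n + 1) := by
        rw [mul_assoc, Real.mul_self_sqrt hA0]
        field_simp
        ring
      _ ≤ _ := by gcongr; exact le_max_right _ _

/-- The subgroup of points charged by some convolution power of a symmetric function. -/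
def convSupport [μ.IsOpenPosMeasure] (hv : IsCc v) (hv0 : ∀ x, 0 ≤ v x) (hvs : ∀ x, v x⁻¹ = v x)
    (hv1 : 0 < v 1) : Subgroup G where
  carrier := {x | ∃ n, 0 < convPow μ v n x}
  one_mem' := ⟨0, hv1⟩
  mul_mem' := by
    rintro x y ⟨n, hn⟩ ⟨k, hk⟩
    refine ⟨n + k + 1, ?_⟩
    rw [← realConv_convPow hv]
    exact realConv_pos (hv.convPow n) (hv.convPow k).continuous (convPow_nonneg hv0 n)
      (convPow_nonneg hv0 k) hn hk
  inv_mem' := by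
    rintro x ⟨n, hn⟩
    exact ⟨n, by rwa [convPow_inv hv hvs]⟩

theorem tsum_shift_le {a : ℕ → ℝ} (ha : ∀ n, 0 ≤ a n) {t : ℝ} (ht : 0 < t)
    (hs : Summable fun n => t ^ n * a n) (j : ℕ) :
    (Summable fun n => t ^ n * a (n + j)) ∧
      ∑' n, t ^ n * a (n + j) ≤ (t⁻¹) ^ j * ∑' n, t ^ n * a n := by
  have h1 : (fun n => t ^ n * a (n + j)) = fun n => (t⁻¹) ^ j * (t ^ (n + j) * a (n + j)) := by
    ext n
    have : t⁻¹ ^ j * t ^ j = 1 := by rw [← mul_pow, inv_mul_cancel₀ ht.ne', one_pow]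
    linear_combination (-(t ^ n * a (n + j))) * this
  have h2 := (summable_nat_add_iff j).2 hs
  rw [h1]
  refine ⟨h2.mul_left _, ?_⟩
  rw [tsum_mul_left]
  refine mul_le_mul_of_nonneg_left ?_ (by positivity)
  rw [← hs.sum_add_tsum_nat_add j]
  exact le_add_of_nonneg_left (Finset.sum_nonneg fun i _ => mul_nonneg (by positivity) (ha i))

/-- The partial sums increase, so compactness lets one of them be positive on all of `S`, hence
bounded below there. -/
theorem exists_le_sum_convPow (hv : IsCc v) (hv0 : ∀ x, 0 ≤ v x) {S : Set G} (hS : IsCompact S)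
    (hSv : ∀ x ∈ S, ∃ n, 0 < convPow μ v n x) :
    ∃ k, ∃ c, 0 < c ∧ ∀ x ∈ S, c ≤ ∑ j ∈ Finset.range k, convPow μ v j x := by
  have ha := convPow_nonneg (μ := μ) hv0
  let P : ℕ → G → ℝ := fun k x => ∑ j ∈ Finset.range k, convPow μ v j x
  have hPc : ∀ k, Continuous (P k) := fun k =>
    continuous_finsetSum _ fun j _ => (hv.convPow j).continuous
  have hPmono : Monotone P := fun i k hik x =>
    Finset.sum_le_sum_of_subset_of_nonneg (Finset.range_mono hik) fun j _ _ => ha j x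
  obtain ⟨k, hk⟩ : ∃ k, S ⊆ {x | 0 < P k x} := by
    refine hS.elim_directed_cover (fun k => {x | 0 < P k x})
      (fun k => isOpen_lt continuous_const (hPc k)) ?_ ?_
    · intro x hx
      obtain ⟨n, hn⟩ := hSv x hx
      refine mem_iUnion.2 ⟨n + 1, hn.trans_le ?_⟩
      exact Finset.single_le_sum (f := fun j => convPow μ v j x) (fun j _ => ha j x)
        (Finset.self_mem_range_succ n)
    · exact (Monotone.directed_le fun i k hik x (hx : 0 < P i x) => hx.trans_le (hPmono hik x))
  exact ⟨k, hS.exists_forall_le' (hPc k).continuousOn hk⟩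

/-- A function dominated by a sum of convolution powers has its convolutions dominated. -/
theorem abs_realConv_convPow_le (hv : IsCc v) (hv0 : ∀ x, 0 ≤ v x) {u : G → ℝ} (hu : IsCc u)
    {k : ℕ} {b : ℝ} (hb : ∀ x, |u x| ≤ b * ∑ j ∈ Finset.range k, convPow μ v j x) (n : ℕ) (x : G) :
    |realConv μ (convPow μ v n) u x| ≤
      b * ∑ j ∈ Finset.range k, convPow μ v (n + (j + 1)) x := by
  have ha := convPow_nonneg (μ := μ) hv0
  have hconvP : realConv μ (convPow μ v n) (fun x => ∑ j ∈ Finset.range k, convPow μ v j x) x =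
      ∑ j ∈ Finset.range k, convPow μ v (n + (j + 1)) x := by
    simp only [realConv, Finset.mul_sum]
    rw [integral_finsetSum _ fun j _ =>
      ((hv.convPow n).mul_inv_mul (hv.convPow j).continuous x).integrable]
    refine Finset.sum_congr rfl fun j _ => ?_
    rw [← add_assoc, ← realConv_convPow hv]
    rfl
  rw [← hconvP, ← realConv_const_mul_right]
  calc |realConv μ (convPow μ v n) u x| ≤ realConv μ (convPow μ v n) (fun y => |u y|) x := by
        refine abs_integral_le_integral_abs.trans_eq ?_
        simp only [realConv, abs_mul, abs_of_nonneg (ha n _)]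
    _ ≤ _ := realConv_mono_right (hv.convPow n) (ha n) hu.continuous.abs
        (continuous_const.mul (continuous_finsetSum _ fun j _ => (hv.convPow j).continuous)) hb x

/-- A comparison principle for the resolvent `h = ∑ tⁿ v⁽ⁿ⁾`. -/
theorem exists_resolvent_le (hv : IsCc v) (hv0 : ∀ x, 0 ≤ v x) {t : ℝ} (ht : 0 < t)
    (hs : ∀ x, Summable fun n => t ^ n * convPow μ v n x) {S : Set G} (hS : IsCompact S)
    (hSv : ∀ x ∈ S, ∃ n, 0 < convPow μ v n x) :
    ∃ C, 0 ≤ C ∧ ∀ (u : G → ℝ) (ε : ℝ), IsCc u → (∀ x, |u x| ≤ ε) → (∀ x, x ∉ S → u x = 0) →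
      ∀ x, (Summable fun n => t ^ n * realConv μ (convPow μ v n) u x) ∧
        |u x + t * ∑' n, t ^ n * realConv μ (convPow μ v n) u x| ≤
          C * ε * ∑' n, t ^ n * convPow μ v n x := by
  have ha := convPow_nonneg (μ := μ) hv0
  obtain ⟨k, c, hc0, hc⟩ := exists_le_sum_convPow hv hv0 hS hSv
  have hD0 : 0 ≤ ∑ j ∈ Finset.range k, (t⁻¹) ^ j :=
    Finset.sum_nonneg fun j _ => by positivity
  -- `u` is dominated by `ε / c` times a sum of `k` convolution powers, and shifting the resolvent
  -- series by `j` costs `t⁻¹ ^ j`. The factor `2` counts the term `u x` and the series, where the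
  -- prefactor `t` absorbs the extra shift.
  refine ⟨2 / c * ∑ j ∈ Finset.range k, (t⁻¹) ^ j, by positivity, fun u ε hu huε huS x => ?_⟩
  have hε : 0 ≤ ε := (abs_nonneg _).trans (huε 1)
  set b := ε / c with hb
  have hb0 : 0 ≤ b := by positivity
  have huP : ∀ x, |u x| ≤ b * ∑ j ∈ Finset.range k, convPow μ v j x := by
    intro x
    by_cases hx : x ∈ S
    · calc |u x| ≤ ε := huε x
        _ = b * c := by rw [hb]; field_simp
        _ ≤ _ := mul_le_mul_of_nonneg_left (hc x hx) hb0
    · rw [huS x hx, abs_zero]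
      exact mul_nonneg hb0 (Finset.sum_nonneg fun j _ => ha j x)
  have hshift := fun j => tsum_shift_le (fun n => ha n x) ht (hs x) j
  have hsingle : ∀ j, convPow μ v j x ≤ (t⁻¹) ^ j * ∑' n, t ^ n * convPow μ v n x := by
    intro j
    have : t ^ j * convPow μ v j x ≤ ∑' n, t ^ n * convPow μ v n x :=
      (hs x).le_tsum j fun i _ => mul_nonneg (by positivity) (ha i x)
    rwa [inv_pow, ← div_eq_inv_mul, le_div_iff₀ (by positivity), mul_comm]
  set h := ∑' n, t ^ n * convPow μ v n x
  set D := ∑ j ∈ Finset.range k, (t⁻¹) ^ j with hD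
  have hconv := fun n => abs_realConv_convPow_le hv hv0 hu huP n x
  have hsum1 : Summable fun n => t ^ n * (b *
      ∑ j ∈ Finset.range k, convPow μ v (n + (j + 1)) x) := by
    simp_rw [Finset.mul_sum]
    refine summable_sum fun j _ => ?_
    refine ((hshift (j + 1)).1.mul_left b).congr fun n => ?_
    ring
  have habs : ∀ n, |t ^ n * realConv μ (convPow μ v n) u x| ≤ t ^ n * (b *
      ∑ j ∈ Finset.range k, convPow μ v (n + (j + 1)) x) := by
    intro n
    rw [abs_mul, abs_of_pos (pow_pos ht n)]
    exact mul_le_mul_of_nonneg_left (hconv n) (pow_pos ht n).le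
  have hsum2 : Summable fun n => |t ^ n * realConv μ (convPow μ v n) u x| :=
    Summable.of_nonneg_of_le (fun _ => abs_nonneg _) habs hsum1
  refine ⟨hsum2.of_abs, ?_⟩
  have h1 : |∑' n, t ^ n * realConv μ (convPow μ v n) u x| ≤ b * (t⁻¹ * D * h) := by
    calc |∑' n, t ^ n * realConv μ (convPow μ v n) u x|
        ≤ ∑' n, |t ^ n * realConv μ (convPow μ v n) u x| := by
          have := hsum2.of_abs.norm
          simp only [← Real.norm_eq_abs]
          exact norm_tsum_le_tsum_norm this
      _ ≤ ∑' n, t ^ n * (b * ∑ j ∈ Finset.range k, convPow μ v (n + (j + 1)) x) :=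
          hsum2.tsum_le_tsum habs hsum1
      _ = b * ∑ j ∈ Finset.range k, ∑' n, t ^ n * convPow μ v (n + (j + 1)) x := by
          rw [← Summable.tsum_finsetSum fun j _ => (hshift (j + 1)).1, ← tsum_mul_left]
          refine tsum_congr fun n => ?_
          rw [← Finset.mul_sum]
          ring
      _ ≤ b * ∑ j ∈ Finset.range k, (t⁻¹) ^ (j + 1) * h :=
          mul_le_mul_of_nonneg_left (Finset.sum_le_sum fun j _ => (hshift (j + 1)).2) hb0
      _ = _ := by
          simp only [pow_succ, ← Finset.sum_mul, ← hD]
          ring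
  have h2 : |u x| ≤ b * (D * h) := by
    refine (huP x).trans (mul_le_mul_of_nonneg_left ?_ hb0)
    rw [hD, Finset.sum_mul]
    exact Finset.sum_le_sum fun j _ => hsingle j
  calc |u x + t * ∑' n, t ^ n * realConv μ (convPow μ v n) u x|
      ≤ |u x| + t * |∑' n, t ^ n * realConv μ (convPow μ v n) u x| := by
        refine (abs_add_le _ _).trans_eq ?_
        rw [abs_mul, abs_of_pos ht]
    _ ≤ b * (D * h) + t * (b * (t⁻¹ * D * h)) :=
        add_le_add h2 (mul_le_mul_of_nonneg_left h1 ht.le)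
    _ = 2 / c * D * ε * h := by rw [hb]; field_simp; ring

/-- Kesten's theorem: on an amenable group, the convolution operator on `L²` by a nonnegative
symmetric function `v` has norm at least the mass of `v`. -/
theorem IsAmenableGroup.integral_le_of_symmetric [LocallyCompactSpace G] [μ.IsOpenPosMeasure]
    (hG : IsAmenableGroup G)
    (hv : IsCc v) (hv0 : ∀ x, 0 ≤ v x) (hvs : ∀ x, v x⁻¹ = v x) (hv1 : 0 < v 1) {r : ℝ}
    (hr0 : 0 < r) (hr : ∀ g, IsCc g → (∀ x, 0 ≤ g x) →
      ∫ x, realConv μ g v x ^ 2 ∂μ ≤ r ^ 2 * ∫ x, g x ^ 2 ∂μ) :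
    ∫ x, v x ∂μ ≤ r := by
  -- Strict room `ρ > r` makes the resolvent at `t = ρ⁻¹` converge geometrically.
  refine le_of_forall_gt_imp_ge_of_dense fun ρ hρ => ?_
  have hρ0 : 0 < ρ := hr0.trans hρ
  obtain ⟨B, hB⟩ := exists_convPow_le hv hv0 hr0 hr
  set t := ρ⁻¹ with ht_def
  have ht : 0 < t := by positivity
  have ha := convPow_nonneg (μ := μ) hv0
  have hgeom : Summable fun n : ℕ => B * (t * r) ^ n := by
    refine (summable_geometric_of_lt_one (by positivity) ?_).mul_left B
    rw [ht_def, ← div_eq_inv_mul]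
    exact (div_lt_one hρ0).2 hρ
  have hterm : ∀ n x, t ^ n * convPow μ v n x ≤ B * (t * r) ^ n := by
    intro n x
    calc t ^ n * convPow μ v n x ≤ t ^ n * (B * r ^ n) := by gcongr; exact hB n x
      _ = _ := by ring
  have hterm0 : ∀ n x, 0 ≤ t ^ n * convPow μ v n x := fun n x =>
    mul_nonneg (by positivity) (ha n x)
  have hs : ∀ x, Summable fun n => t ^ n * convPow μ v n x := fun x =>
    Summable.of_nonneg_of_le (fun n => hterm0 n x) (fun n => hterm n x) hgeom
  let h : G → ℝ := fun x => ∑' n, t ^ n * convPow μ v n x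
  let H : Subgroup G := convSupport (μ := μ) hv hv0 hvs hv1
  have hHmem : ∀ x ∈ H, ∃ n, 0 < convPow μ v n x := fun x hx => hx
  have hHo : IsOpen (H : Set G) := by
    have : (H : Set G) = ⋃ n, {x | 0 < convPow μ v n x} := by
      ext x
      rw [mem_iUnion]
      exact Iff.rfl
    rw [this]
    exact isOpen_iUnion fun n => isOpen_lt continuous_const (hv.convPow n).continuous
  have hHc : IsClosed (H : Set G) := H.isClosed_of_isOpen hHo
  have hvH : ∀ x, v x ≠ 0 → x ∈ H := fun x hx => ⟨0, (hv0 x).lt_of_ne hx.symm⟩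
  have htH : tsupport v ⊆ H := closure_minimal hvH hHc
  have hpos : ∀ x ∈ H, 0 < h x := by
    rintro x ⟨n, hn⟩
    exact (hs x).tsum_pos (fun k => hterm0 k x) n (mul_pos (pow_pos ht n) hn)
  have hcontH : Continuous h := by
    refine continuous_tsum (fun n => continuous_const.mul (hv.convPow n).continuous) hgeom ?_
    intro n x
    rw [Real.norm_of_nonneg (hterm0 n x)]
    exact hterm n x
  -- Right translation passes onto the last factor `v` of each power. Translates and differences of
  -- translates of `h` thus come under `exists_resolvent_le`, which yields the Harnack bounds.
  have htrans : ∀ x y, h (x * y) = v (x * y) +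
      t * ∑' n, t ^ n * realConv μ (convPow μ v n) (fun z => v (z * y)) x := by
    intro x y
    simp only [h]
    rw [(hs _).tsum_eq_zero_add, ← tsum_mul_left]
    simp only [pow_zero, one_mul, convPow, realConv_comp_mul_right, pow_succ]
    congr 2; ext n
    ring
  obtain ⟨V, hV⟩ := hv.continuous.bounded_above_of_compact_support hv.compact
  have hsupp : ∀ x y, x ∉ tsupport v * ({y} : Set G)⁻¹ → v (x * y) = 0 := by
    intro x y hx
    by_contra hne
    exact hx ⟨x * y, subset_closure hne, y⁻¹, by simp, by simp⟩
  refine hG.integral_le_of_superharmonic H hHo hv hv0 hvs hvH hcontH hpos ?_ ?_ ?_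
  · intro y hy
    have hSH : ∀ x ∈ tsupport v * ({y} : Set G)⁻¹, x ∈ H := by
      rintro _ ⟨a, ha, b, hb, rfl⟩
      have : b⁻¹ = y := by rw [show b = y⁻¹ by simpa using hb, inv_inv]
      exact H.mul_mem (htH ha) (by rw [← H.inv_mem_iff, this]; exact hy)
    obtain ⟨C, -, hC⟩ := exists_resolvent_le hv hv0 ht hs
      ((hv.compact : IsCompact _).mul isCompact_singleton.inv) fun x hx => hHmem x (hSH x hx)
    refine ⟨C * V, fun x _ => ?_⟩
    rw [htrans]
    exact (le_abs_self _).trans (hC _ V (hv.comp_mul_right y) (fun x => hV _)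
      (fun x hx => hsupp x y hx) x).2
  · intro y hy ε hε
    obtain ⟨N, hN, hNH, hNc⟩ := local_compact_nhds (hHo.mem_nhds hy)
    have hSc : IsCompact (tsupport v * N⁻¹) := (hv.compact : IsCompact _).mul hNc.inv
    have hSH : ∀ x ∈ tsupport v * N⁻¹, x ∈ H := by
      rintro _ ⟨a, ha, b, hb, rfl⟩
      exact H.mul_mem (htH ha) (H.inv_mem_iff.1 (hNH hb))
    obtain ⟨C, hC0, hC⟩ := exists_resolvent_le hv hv0 ht hs hSc fun x hx => hHmem x (hSH x hx)
    have hδ : 0 < ε / (C + 1) := by positivity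
    have hzero : ∀ z ∈ N, ∀ x, x ∉ tsupport v * N⁻¹ → v (x * z) = 0 := by
      intro z hz x hx
      refine hsupp x z fun h => hx (mul_subset_mul_left ?_ h)
      simpa using hz
    have hunif : ∀ᶠ z in 𝓝 y, ∀ x ∈ tsupport v * N⁻¹, |v (x * z) - v (x * y)| < ε / (C + 1) := by
      refine hSc.eventually_forall_of_forall_eventually fun x _ => ?_
      have hc : Continuous fun q : G × G => |v (q.2 * q.1) - v (q.2 * y)| :=
        ((hv.continuous.comp (continuous_snd.mul continuous_fst)).sub
          (hv.continuous.comp (continuous_snd.mul continuous_const))).abs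
      refine hc.continuousAt.eventually_lt continuousAt_const ?_
      simpa using hδ
    filter_upwards [hunif, hN] with z hz hzN x _
    have hyN : y ∈ N := mem_of_mem_nhds hN
    have hy1 := hC _ V (hv.comp_mul_right y) (fun x => hV _) (hzero y hyN) x
    have hz1 := hC _ V (hv.comp_mul_right z) (fun x => hV _) (hzero z hzN) x
    have hzy := hC _ (ε / (C + 1)) ((hv.comp_mul_right z).sub (hv.comp_mul_right y)) (fun x => by
      by_cases hx : x ∈ tsupport v * N⁻¹
      · exact (hz x hx).le
      · rw [hzero y hyN x hx, hzero z hzN x hx]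
        simpa using hδ.le) (fun x hx => by rw [hzero y hyN x hx, hzero z hzN x hx, sub_zero]) x
    have heq : h (x * z) - h (x * y) = v (x * z) - v (x * y) + t * ∑' n, t ^ n *
        realConv μ (convPow μ v n) (fun x => v (x * z) - v (x * y)) x := by
      have hn : ∀ n, realConv μ (convPow μ v n) (fun x => v (x * z) - v (x * y)) x =
          realConv μ (convPow μ v n) (fun x => v (x * z)) x -
            realConv μ (convPow μ v n) (fun x => v (x * y)) x := fun n =>
        realConv_sub_right (hv.convPow n) (hv.comp_mul_right z).continuous
          (hv.comp_mul_right y).continuous x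
      simp_rw [hn, mul_sub]
      rw [hz1.1.tsum_sub hy1.1, htrans, htrans]
      ring
    rw [heq]
    refine hzy.2.trans ?_
    have hle : C * (ε / (C + 1)) ≤ ε := by
      rw [← mul_div_assoc, div_le_iff₀ (by positivity)]
      nlinarith
    exact mul_le_mul_of_nonneg_right hle (tsum_nonneg fun n => hterm0 n x)
  -- By symmetry of `v` the integral is `(h * v) x`, which is `ρ` times the resolvent series without
  -- its zeroth term.
  · intro x _
    have hint : ∀ n, ∫ y, t ^ n * convPow μ v n (x * y) * v y ∂μ =
        t ^ n * convPow μ v (n + 1) x := by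
      intro n
      simp_rw [mul_assoc]
      rw [integral_const_mul, convPow, realConv]
      rw [← integral_mul_left_eq_self (fun y => convPow μ v n y * v (y⁻¹ * x)) x]
      congr 2; ext y
      simp [hvs]
    have hI : ∀ n, Integrable (fun y => t ^ n * convPow μ v n (x * y) * v y) μ := fun n =>
      ((((hv.convPow n).comp_mul_left x).const_mul (t ^ n)).mul hv.continuous).integrable
    have hs1 : Summable fun n => t ^ (n + 1) * convPow μ v (n + 1) x :=
      (summable_nat_add_iff 1).2 (hs x)
    have hs2 : Summable fun n => t ^ n * convPow μ v (n + 1) x := by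
      refine (hs1.mul_left ρ).congr fun n => ?_
      rw [pow_succ, ht_def]
      field_simp
    have hsum := hasSum_integral_of_summable_integral_norm hI (by
      refine hs2.congr fun n => ?_
      rw [← hint]
      congr 1; ext y
      rw [Real.norm_of_nonneg (mul_nonneg (hterm0 n _) (hv0 y))])
    simp_rw [hint] at hsum
    have h1 : ∫ y, h (x * y) * v y ∂μ = ∑' n, t ^ n * convPow μ v (n + 1) x := by
      rw [hsum.tsum_eq]
      congr 1; ext y
      rw [← tsum_mul_right]
    rw [h1]
    calc ∑' n, t ^ n * convPow μ v (n + 1) x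
        = ρ * ∑' n, t ^ (n + 1) * convPow μ v (n + 1) x := by
          rw [← tsum_mul_left]
          congr 1; ext n
          rw [pow_succ, ht_def]
          field_simp
      _ ≤ ρ * h x := by
          gcongr
          simp only [h]
          rw [(hs x).tsum_eq_zero_add]
          exact le_add_of_nonneg_left (hterm0 0 x)

end ConvolutionPowers

/-! ### From Kesten's theorem to a lower bound for convolution norms on `Lᵖ`. -/

section Core

variable {G : Type*} [Group G] [TopologicalSpace G] [IsTopologicalGroup G] [T2Space G]
  [MeasurableSpace G] [BorelSpace G] {μ : Measure G} [IsFiniteMeasureOnCompacts μ]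
  [μ.IsMulLeftInvariant] [μ.IsInvInvariant] {v w : G → ℝ}

/-- Right convolution by `v` has `L²` norm at most `r` on nonnegative functions in `C₀₀(G)`. -/
def ConvBoundL2 (μ : Measure G) (v : G → ℝ) (r : ℝ) : Prop :=
  ∀ g, IsCc g → (∀ x, 0 ≤ g x) → ∫ x, realConv μ g v x ^ 2 ∂μ ≤ r ^ 2 * ∫ x, g x ^ 2 ∂μ

/-- Weighted Cauchy–Schwarz, `(a + b)² ≤ (r + s) (a² / r + b² / s)`, keeps the constant equal to `r
+ s`. -/
theorem ConvBoundL2.add {r s : ℝ} (hv : IsCc v) (hw : IsCc w) (hr : 0 < r) (hs : 0 < s)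
    (h1 : ConvBoundL2 μ v r) (h2 : ConvBoundL2 μ w s) :
    ConvBoundL2 μ (fun x => v x + w x) (r + s) := by
  intro g hg hg0
  have hi1 := (hg.realConv hv (μ := μ)).sq.integrable (μ := μ)
  have hi2 := (hg.realConv hw (μ := μ)).sq.integrable (μ := μ)
  have hsum : IsCc fun x => v x + w x := hv.add hw
  calc ∫ x, realConv μ g (fun x => v x + w x) x ^ 2 ∂μ
      ≤ ∫ x, ((r + s) / r * realConv μ g v x ^ 2 + (r + s) / s * realConv μ g w x ^ 2) ∂μ := by
        refine integral_mono (hg.realConv hsum).sq.integrable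
          ((hi1.const_mul _).add (hi2.const_mul _)) fun x => ?_
        simp only [realConv_add_right hg hv.continuous hw.continuous]
        set a := realConv μ g v x
        set b := realConv μ g w x
        have : (r + s) / r * a ^ 2 + (r + s) / s * b ^ 2 - (a + b) ^ 2 =
            (s * a - r * b) ^ 2 / (r * s) := by field_simp; ring
        have h3 : 0 ≤ (s * a - r * b) ^ 2 / (r * s) := by positivity
        linarith
    _ = (r + s) / r * ∫ x, realConv μ g v x ^ 2 ∂μ + (r + s) / s * ∫ x, realConv μ g w x ^ 2 ∂μ := by
        rw [integral_add (hi1.const_mul _) (hi2.const_mul _), integral_const_mul,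
          integral_const_mul]
    _ ≤ (r + s) / r * (r ^ 2 * ∫ x, g x ^ 2 ∂μ) + (r + s) / s * (s ^ 2 * ∫ x, g x ^ 2 ∂μ) := by
        gcongr
        · exact h1 g hg hg0
        · exact h2 g hg hg0
    _ = _ := by field_simp

/-- The adjoint of a convolution operator has the same norm. -/
theorem ConvBoundL2.comp_inv {r : ℝ} (hv : IsCc v) (hv0 : ∀ x, 0 ≤ v x) (hr : 0 < r)
    (h : ConvBoundL2 μ v r) : ConvBoundL2 μ (fun x => v x⁻¹) r := by
  intro g hg hg0
  set k := realConv μ g fun x => v x⁻¹ with hk_def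
  have hk : IsCc k := hg.realConv hv.comp_inv
  have hk0 : ∀ x, 0 ≤ k x := realConv_nonneg hg0 fun x => hv0 _
  have h1 : ∫ x, k x ^ 2 ∂μ = ∫ x, g x * realConv μ k v x ∂μ := by
    have := integral_realConv_mul (μ := μ) hg hv.comp_inv hk
    simp only [inv_inv] at this
    rw [← this]
    simp only [sq]
    rfl
  set A := ∫ x, k x ^ 2 ∂μ with hA
  set B := ∫ x, g x ^ 2 ∂μ with hB
  have hA0 : 0 ≤ A := integral_nonneg fun x => sq_nonneg _
  have hB0 : 0 ≤ B := integral_nonneg fun x => sq_nonneg _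
  -- Duality: `‖k‖² = ⟨g, k * v⟩ ≤ ‖g‖ · r‖k‖`.
  have h2 : A ≤ √B * (r * √A) := by
    refine h1.le.trans <| (integral_mul_le_sqrt_mul_sqrt hg (hk.realConv hv) hg0
      (realConv_nonneg hk0 hv0)).trans ?_
    gcongr
    calc √(∫ x, realConv μ k v x ^ 2 ∂μ) ≤ √(r ^ 2 * A) := Real.sqrt_le_sqrt (h k hk hk0)
      _ = r * √A := by rw [Real.sqrt_mul (sq_nonneg r), Real.sqrt_sq hr.le]
  rcases hA0.eq_or_lt with h0 | hpos
  · rw [← h0]; positivity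
  have h3 : √A ≤ r * √B := by
    have h4 : 0 < √A := Real.sqrt_pos.2 hpos
    have h5 : √A * √A = A := Real.mul_self_sqrt hA0
    nlinarith
  calc A = √A ^ 2 := (Real.sq_sqrt hA0).symm
    _ ≤ (r * √B) ^ 2 := by gcongr
    _ = r ^ 2 * B := by rw [mul_pow, Real.sq_sqrt hB0]

variable [LocallyCompactSpace G] [μ.IsOpenPosMeasure] [μ.IsMulRightInvariant]

/-- Kesten's theorem is applied to `v x + v x⁻¹ + u x`, with `u` a symmetric bump positive at `1`.
By Young, `u` has norm at most its mass `e`, so `2 ∫ v + e ≤ 2 r + e` and `e` cancels. -/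
theorem IsAmenableGroup.integral_le_of_convBoundL2 (hG : IsAmenableGroup G) (hv : IsCc v)
    (hv0 : ∀ x, 0 ≤ v x) {r : ℝ} (hr : 0 < r) (h : ConvBoundL2 μ v r) : ∫ x, v x ∂μ ≤ r := by
  obtain ⟨⟨u₀, hu₀c⟩, hu₀s, hu₀0, hu₀1⟩ : ∃ u : C(G, ℝ), HasCompactSupport u ∧ 0 ≤ u ∧ u 1 ≠ 0 :=
    exists_continuous_nonneg_pos 1
  have hu₀ : IsCc u₀ := ⟨hu₀c, hu₀s⟩
  replace hu₀0 : ∀ x, 0 ≤ u₀ x := hu₀0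
  replace hu₀1 : 0 < u₀ 1 := (hu₀0 1).lt_of_ne (Ne.symm hu₀1)
  let u : G → ℝ := fun x => u₀ x + u₀ x⁻¹
  have hu : IsCc u := hu₀.add hu₀.comp_inv
  have hu0 : ∀ x, 0 ≤ u x := fun x => add_nonneg (hu₀0 _) (hu₀0 _)
  have hu1 : 0 < u 1 := by simpa [u] using hu₀1
  set e := ∫ x, u x ∂μ
  have he : 0 < e :=
    hu.continuous.integral_pos_of_hasCompactSupport_nonneg_nonzero hu.compact hu0 hu1.ne'
  have hub : ConvBoundL2 μ u e := by
    intro g hg hg0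
    have := integral_realConv_rpow_le (μ := μ) hg hu hg0 hu0 (s := 2) one_le_two
    simp only [Real.rpow_two] at this
    rwa [mul_comm]
  have hsym : IsCc fun x => v x + v x⁻¹ := hv.add hv.comp_inv
  have hb := ((h.add hv hv.comp_inv hr hr (h.comp_inv hv hv0 hr))).add hsym hu (by positivity) he hub
  have hle := hG.integral_le_of_symmetric (hsym.add hu)
    (fun x => add_nonneg (add_nonneg (hv0 _) (hv0 _)) (hu0 _))
    (fun x => by simp only [u, inv_inv]; ring)
    (add_pos_of_nonneg_of_pos (add_nonneg (hv0 _) (hv0 _)) hu1) (by positivity) hb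
  rw [integral_add hsym.integrable hu.integrable, integral_add hv.integrable
    hv.comp_inv.integrable, integral_inv_eq_self v μ] at hle
  linarith

/-- On an amenable group, right convolution by `v ≥ 0` on `Lᵖ`, `1 ≤ p ≤ 2`, has norm at least the
mass of `v`. -/
theorem IsAmenableGroup.integral_le_of_convBound (hG : IsAmenableGroup G) (hv : IsCc v)
    (hv0 : ∀ x, 0 ≤ v x) {p C : ℝ} (hp1 : 1 ≤ p) (hp2 : p ≤ 2) (hC : 0 < C)
    (h : ∀ g, IsCc g → (∀ x, 0 ≤ g x) →
      ∫ x, realConv μ g v x ^ p ∂μ ≤ C ^ p * ∫ x, g x ^ p ∂μ) : ∫ x, v x ∂μ ≤ C := by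
  have hp0 : 0 < p := by linarith
  set M := ∫ x, v x ∂μ with hM
  rcases le_or_gt M 0 with hM0 | hM0
  · exact hM0.trans hC.le
  have hs : 1 ≤ 2 / p := (one_le_div hp0).2 hp2
  have hs0 : 0 < 2 / p := by positivity
  set K := C ^ p * M ^ (2 - p) with hK
  have hK0 : 0 < K := by positivity
  -- Jensen bounds `(g * v)²` by `(g ^ (2/p) * v) ^ p` times `M ^ (2 - p)`, reducing `L²` to the
  -- `Lᵖ` hypothesis; `2 / p ≥ 1` is where `p ≤ 2` enters. Kesten's bound `M² ≤ K = C ^ p * M ^ (2 -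
  -- p)` then gives `M ≤ C`.
  have hb : ConvBoundL2 μ v (√K) := by
    intro g hg hg0
    have hgs := hg.rpow hs0
    have hgs0 : ∀ x, 0 ≤ g x ^ (2 / p) := fun x => Real.rpow_nonneg (hg0 x) _
    have hpt : ∀ x, realConv μ g v x ^ 2 ≤
        realConv μ (fun y => g y ^ (2 / p)) v x ^ p * M ^ (2 - p) := by
      intro x
      have h0 := realConv_nonneg (μ := μ) hg0 hv0 x
      have h1 := realConv_rpow_le (μ := μ) hg hv hg0 hv0 hs x
      have h2 := Real.rpow_le_rpow (Real.rpow_nonneg h0 _) h1 hp0.le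
      rw [← Real.rpow_mul h0, div_mul_cancel₀ _ hp0.ne', Real.rpow_two,
        Real.mul_rpow (realConv_nonneg hgs0 hv0 x) (Real.rpow_nonneg hM0.le _),
        ← Real.rpow_mul hM0.le, sub_mul, div_mul_cancel₀ _ hp0.ne', one_mul] at h2
      exact h2
    rw [Real.sq_sqrt hK0.le]
    calc ∫ x, realConv μ g v x ^ 2 ∂μ
        ≤ ∫ x, realConv μ (fun y => g y ^ (2 / p)) v x ^ p * M ^ (2 - p) ∂μ :=
          integral_mono (hg.realConv hv).sq.integrable
            (((hgs.realConv hv).rpow hp0).integrable.mul_const _) hpt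
      _ = (∫ x, realConv μ (fun y => g y ^ (2 / p)) v x ^ p ∂μ) * M ^ (2 - p) :=
          integral_mul_const _ _
      _ ≤ (C ^ p * ∫ x, (g x ^ (2 / p)) ^ p ∂μ) * M ^ (2 - p) := by
          gcongr
          exact h _ hgs hgs0
      _ = K * ∫ x, g x ^ 2 ∂μ := by
          have : ∀ x, (g x ^ (2 / p)) ^ p = g x ^ 2 := fun x => by
            rw [← Real.rpow_mul (hg0 x), div_mul_cancel₀ _ hp0.ne', Real.rpow_two]
          simp_rw [this]
          rw [hK]; ring
  have hle := hG.integral_le_of_convBoundL2 hv hv0 (Real.sqrt_pos.2 hK0) hb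
  rw [← hM] at hle
  have h2 : M ^ 2 ≤ K := by
    calc M ^ 2 ≤ √K ^ 2 := by gcongr
      _ = K := Real.sq_sqrt hK0.le
  have h3 : M ^ p ≤ C ^ p := by
    have h4 : M ^ p * M ^ (2 - p) = M ^ 2 := by
      rw [← Real.rpow_add hM0, add_sub_cancel, Real.rpow_two]
    rw [← h4] at h2
    exact le_of_mul_le_mul_right h2 (Real.rpow_pos_of_pos hM0 _)
  exact (Real.rpow_le_rpow_iff hM0.le hC.le hp0).1 h3

end Core

/-! ### Density of `C₀₀` in `Lᵖ` and Young's inequality for general functions. -/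

section Young

variable {G : Type*} [Group G] [TopologicalSpace G] [IsTopologicalGroup G] [T2Space G]
  [MeasurableSpace G] [BorelSpace G] {μ : Measure G}

/-- In a locally compact Hausdorff space, functions in `C₀₀` are dense in `Lᵖ`. -/
theorem MeasureTheory.MemLp.exists_hasCompactSupport_eLpNorm_sub_le_of_t2 {X : Type*}
    [TopologicalSpace X] [T2Space X] [LocallyCompactSpace X] [MeasurableSpace X] [BorelSpace X]
    {μ : Measure X} [μ.Regular] {p : ℝ≥0∞} (hp : p ≠ ∞) {f : X → ℂ} (hf : MemLp f p μ)
    {ε : ℝ≥0∞} (hε : ε ≠ 0) :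
    ∃ g : X → ℂ, eLpNorm (f - g) p μ ≤ ε ∧ Continuous g ∧ MemLp g p μ ∧ HasCompactSupport g := by
  apply hf.induction_dense hp _ _ _ _ hε
  rotate_left
  · rintro f g ⟨f_cont, f_mem, hf⟩ ⟨g_cont, g_mem, hg⟩
    exact ⟨f_cont.add g_cont, f_mem.add g_mem, hf.add hg⟩
  · rintro f ⟨_, f_mem, _⟩
    exact f_mem.aestronglyMeasurable
  intro c t ht htμ ε hε
  rcases exists_Lp_half ℂ μ p hε with ⟨δ, δpos, hδ⟩
  obtain ⟨η, ηpos, hη⟩ : ∃ η : NNReal, 0 < η ∧ ∀ s : Set X, μ s ≤ η →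
      eLpNorm (s.indicator fun _ => c) p μ ≤ δ := exists_eLpNorm_indicator_le hp c δpos.ne'
  have hη0 : (η : ℝ≥0∞) ≠ 0 := (ENNReal.coe_pos.2 ηpos).ne'
  obtain ⟨s, st, s_compact, s_closed, μs⟩ := ht.exists_isCompact_isClosed_sdiff_lt htμ.ne hη0
  have hsμ : μ s ≠ ∞ := ((measure_mono st).trans_lt htμ).ne
  obtain ⟨V, sV, V_open, -, hV⟩ := s_closed.measurableSet.exists_isOpen_sdiff_lt hsμ hη0
  obtain ⟨φ, hφ1, hφ0, hφs, hφI⟩ := exists_continuous_one_zero_of_isCompact s_compact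
    V_open.isClosed_compl (disjoint_compl_right_iff_subset.2 sV)
  have hcont : Continuous fun x => (φ x : ℂ) * c :=
    (Complex.continuous_ofReal.comp φ.continuous).mul continuous_const
  have hsupp : HasCompactSupport fun x => (φ x : ℂ) * c :=
    HasCompactSupport.mul_right (hφs.comp_left (g := fun r : ℝ => (r : ℂ)) Complex.ofReal_zero)
  have hmem : MemLp (fun x => (φ x : ℂ) * c) p μ := hcont.memLp_of_hasCompactSupport hsupp
  have I1 : eLpNorm ((s.indicator fun _ => c) - t.indicator fun _ => c) p μ ≤ δ := by
    rw [← eLpNorm_neg, neg_sub, ← indicator_sdiff st]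
    exact hη _ μs.le
  have I2 : eLpNorm ((fun x => (φ x : ℂ) * c) - s.indicator fun _ => c) p μ ≤ δ := by
    refine (eLpNorm_mono fun x => ?_).trans (hη _ hV.le)
    by_cases hs : x ∈ s
    · simp [hs, hφ1 hs]
    by_cases hv : x ∈ V
    · have h1 : ‖φ x‖ ≤ 1 := by
        rw [Real.norm_of_nonneg (hφI x).1]
        exact (hφI x).2
      simpa [hs, hv] using mul_le_of_le_one_left (norm_nonneg c) h1
    · simp [hs, hv, hφ0 hv]
  refine ⟨_, ?_, hcont, hmem, hsupp⟩
  have hm : ∀ {u : Set X}, MeasurableSet u →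
      AEStronglyMeasurable (u.indicator fun _ => c) μ := fun hu =>
    aestronglyMeasurable_const.indicator hu
  have := (hδ _ _ (hmem.1.sub (hm s_closed.measurableSet))
    ((hm s_closed.measurableSet).sub (hm ht)) I2 I1).le
  simpa only [sub_add_sub_cancel] using this

/-- An `Lᵖ` function is an almost everywhere limit of functions in `C₀₀(G)` of almost the same norm,
dominated by a series that is summable in `Lᵖ`. -/
theorem MeasureTheory.MemLp.exists_approx [LocallyCompactSpace G] [μ.Regular] {p : ℝ≥0∞}
    (hp1 : 1 ≤ p) (hp : p ≠ ∞) {f : G → ℂ}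
    (hf : MemLp f p μ) {ε : ℝ≥0∞} (hε : ε ≠ 0) (hε' : ε ≠ ∞) :
    ∃ (Φ : ℕ → G → ℂ) (d : ℕ → G → ℝ), (∀ n, Continuous (Φ n) ∧ HasCompactSupport (Φ n)) ∧
      (∀ n, eLpNorm (Φ n) p μ ≤ eLpNorm f p μ + ε) ∧
      (∀ᵐ x ∂μ, Tendsto (fun n => Φ n x) atTop (𝓝 (f x))) ∧
      (∀ n, IsCc (d n)) ∧ (∀ n x, 0 ≤ d n x) ∧ ∑' n, eLpNorm (d n) p μ ≠ ∞ ∧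
      ∀ n x, ‖Φ n x‖ ≤ ∑ k ∈ Finset.range (n + 1), d k x := by
  -- Geometric accuracy makes the increments `d` summable in norm, which gives both almost
  -- everywhere convergence and domination by a telescoping sum.
  have hδ : ∀ n : ℕ, ε * 2⁻¹ ^ n ≠ 0 := fun n => mul_ne_zero hε (pow_ne_zero _ (by simp))
  choose Φ hΦd hΦc hΦm hΦs using fun n =>
    hf.exists_hasCompactSupport_eLpNorm_sub_le_of_t2 hp (hδ n)
  have hgeom : ∑' n : ℕ, ε * 2⁻¹ ^ n ≠ ∞ := by
    rw [ENNReal.tsum_mul_left, ENNReal.tsum_geometric]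
    refine ENNReal.mul_ne_top hε' ?_
    simp
  have hle : ∀ n : ℕ, ε * 2⁻¹ ^ n ≤ ε := fun n =>
    mul_le_of_le_one_right' (pow_le_one₀ (by simp) (by simp))
  let d : ℕ → G → ℝ := fun n => Nat.casesOn n (fun x => ‖Φ 0 x‖) fun k x => ‖Φ (k + 1) x - Φ k x‖
  have hdL : ∀ k, eLpNorm (d (k + 1)) p μ ≤ ε * 2⁻¹ ^ (k + 1) + ε * 2⁻¹ ^ k := by
    intro k
    have h1 : eLpNorm (d (k + 1)) p μ = eLpNorm ((f - Φ k) - (f - Φ (k + 1))) p μ := by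
      rw [sub_sub_sub_cancel_left]
      exact eLpNorm_norm (Φ (k + 1) - Φ k)
    rw [h1]
    exact (eLpNorm_sub_le (hf.sub (hΦm k)).1 (hf.sub (hΦm (k + 1))).1 hp1).trans
      ((add_le_add (hΦd k) (hΦd (k + 1))).trans_eq (add_comm _ _))
  refine ⟨Φ, d, fun n => ⟨hΦc n, hΦs n⟩, ?_, ?_, ?_, ?_, ?_, ?_⟩
  · intro n
    have h1 : Φ n = f - (f - Φ n) := by simp
    rw [h1]
    refine (eLpNorm_sub_le hf.1 (hf.sub (hΦm n)).1 hp1).trans ?_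
    gcongr
    exact (hΦd n).trans (hle n)
  · have := summable_norm_of_tsum_eLpNorm_ne_top hp1 (fun n => (hf.sub (hΦm n)).1)
      (ne_top_of_le_ne_top hgeom (ENNReal.tsum_le_tsum hΦd))
    filter_upwards [this] with x hx
    have h1 := tendsto_zero_iff_norm_tendsto_zero.2 hx.tendsto_atTop_zero
    simpa using h1.const_sub (f x)
  · rintro (_ | n)
    · exact ⟨(hΦc 0).norm, (hΦs 0).norm⟩
    · exact ⟨((hΦc (n + 1)).sub (hΦc n)).norm, ((hΦs (n + 1)).sub (hΦs n)).norm⟩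
  · rintro (_ | n) x
    · exact norm_nonneg _
    · exact norm_nonneg _
  · rw [tsum_eq_zero_add' ENNReal.summable]
    refine ENNReal.add_ne_top.2 ⟨?_, ?_⟩
    · exact (eLpNorm_norm (Φ 0)).trans_ne (hΦm 0).2.ne
    · refine ne_top_of_le_ne_top ?_ (ENNReal.tsum_le_tsum hdL)
      rw [ENNReal.tsum_add]
      refine ENNReal.add_ne_top.2 ⟨ne_top_of_le_ne_top hgeom ?_, hgeom⟩
      exact ENNReal.tsum_comp_le_tsum_of_injective (add_left_injective 1) _
  · intro n x
    induction n with
    | zero => simp [d]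
    | succ n ih =>
      rw [Finset.sum_range_succ]
      have : Φ (n + 1) x = Φ n x + (Φ (n + 1) x - Φ n x) := by ring
      rw [this]
      exact (norm_add_le _ _).trans (add_le_add ih le_rfl)

theorem continuous_groupConv [IsFiniteMeasureOnCompacts μ] {ψ φ : G → ℂ} (hψ : Continuous ψ)
    (hψs : HasCompactSupport ψ) (hφ : Continuous φ) : Continuous (groupConv μ ψ φ) := by
  rw [← continuousOn_univ]
  refine continuousOn_integral_of_compact_support (k := tsupport ψ) hψs ?_ ?_
  · exact Continuous.continuousOn ((hψ.comp continuous_snd).mul (hφ.comp (by fun_prop)))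
  · intro p x _ hx
    simp [image_eq_zero_of_notMem_tsupport hx]

theorem IsCc.eLpNorm_eq [IsFiniteMeasureOnCompacts μ] {f : G → ℝ} (hf : IsCc f)
    (hf0 : ∀ x, 0 ≤ f x) {p : ℝ≥0∞} (hp0 : p ≠ 0) (hp : p ≠ ∞) :
    eLpNorm f p μ = ENNReal.ofReal ((∫ x, f x ^ p.toReal ∂μ) ^ p.toReal⁻¹) := by
  rw [(hf.memLp p).eLpNorm_eq_integral_rpow_norm hp0 hp]
  simp only [Real.norm_of_nonneg (hf0 _)]

variable [μ.IsMulLeftInvariant] [μ.IsInvInvariant] [μ.IsMulRightInvariant]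

theorem eLpNorm_realConv_le [IsFiniteMeasureOnCompacts μ] {f g : G → ℝ} (hf : IsCc f) (hg : IsCc g) (hf0 : ∀ x, 0 ≤ f x)
    (hg0 : ∀ x, 0 ≤ g x) {p : ℝ≥0∞} (hp1 : 1 ≤ p) (hp : p ≠ ∞) :
    eLpNorm (realConv μ f g) p μ ≤ eLpNorm f p μ * eLpNorm g 1 μ := by
  have hp0 : p ≠ 0 := (zero_lt_one.trans_le hp1).ne'
  have hpr : 1 ≤ p.toReal := by
    simpa using (ENNReal.toReal_le_toReal ENNReal.one_ne_top hp).2 hp1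
  have hpr0 : 0 < p.toReal := by linarith
  rw [(hf.realConv hg).eLpNorm_eq (realConv_nonneg hf0 hg0) hp0 hp, hf.eLpNorm_eq hf0 hp0 hp,
    hg.eLpNorm_eq hg0 one_ne_zero ENNReal.one_ne_top]
  have hA : 0 ≤ ∫ x, f x ^ p.toReal ∂μ := integral_nonneg fun x => Real.rpow_nonneg (hf0 x) _
  have hB : 0 ≤ ∫ x, g x ∂μ := integral_nonneg hg0
  rw [← ENNReal.ofReal_mul (by positivity)]
  refine ENNReal.ofReal_le_ofReal ?_
  simp only [ENNReal.toReal_one, Real.rpow_one, inv_one]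
  refine (Real.rpow_le_rpow (integral_nonneg fun x => Real.rpow_nonneg
    (realConv_nonneg hf0 hg0 x) _) (integral_realConv_rpow_le hf hg hf0 hg0 hpr)
    (by positivity)).trans_eq ?_
  rw [Real.mul_rpow hA (by positivity), ← Real.rpow_mul hB, mul_inv_cancel₀ hpr0.ne',
    Real.rpow_one]

theorem eLpNorm_groupConv_le_of_hasCompactSupport [IsFiniteMeasureOnCompacts μ]
    {ψ φ : G → ℂ} (hψ : Continuous ψ)
    (hψs : HasCompactSupport ψ) (hφ : Continuous φ) (hφs : HasCompactSupport φ) {p : ℝ≥0∞}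
    (hp1 : 1 ≤ p) (hp : p ≠ ∞) :
    eLpNorm (groupConv μ ψ φ) p μ ≤ eLpNorm ψ p μ * eLpNorm φ 1 μ := by
  rw [← eLpNorm_norm ψ, ← eLpNorm_norm φ]
  refine le_trans (eLpNorm_mono_real fun x => ?_) (eLpNorm_realConv_le ⟨hψ.norm, hψs.norm⟩
    ⟨hφ.norm, hφs.norm⟩ (fun x => norm_nonneg _) (fun x => norm_nonneg _) hp1 hp)
  refine (norm_integral_le_integral_norm _).trans_eq ?_
  simp only [norm_mul, realConv]

theorem quasiMeasurePreserving_inv_mul (x : G) :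
    Measure.QuasiMeasurePreserving (fun y => y⁻¹ * x) μ μ :=
  ((measurePreserving_mul_right μ x).comp (Measure.measurePreserving_inv μ)).quasiMeasurePreserving

/-- If `γ * d` has a convergent double series at `x`, then the products are dominated. -/
theorem exists_integrable_bound [IsFiniteMeasureOnCompacts μ]
    {γ d : ℕ → G → ℝ} (hγ : ∀ n, IsCc (γ n)) (hd : ∀ n, IsCc (d n))
    (hγ0 : ∀ n x, 0 ≤ γ n x) (hd0 : ∀ n x, 0 ≤ d n x) {x : G}
    (hx : Summable fun i : ℕ × ℕ => realConv μ (γ i.1) (d i.2) x) :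
    ∃ b : G → ℝ, Integrable b μ ∧ ∀ᵐ y ∂μ, ∀ n,
      (∑ k ∈ Finset.range n, γ k y) * (∑ k ∈ Finset.range n, d k (y⁻¹ * x)) ≤ b y := by
  let e : ℕ × ℕ → G → ℝ := fun i y => γ i.1 y * d i.2 (y⁻¹ * x)
  have he : ∀ i, IsCc (e i) := fun i => (hγ i.1).mul_inv_mul (hd i.2).continuous x
  have he0 : ∀ i y, 0 ≤ e i y := fun i y => mul_nonneg (hγ0 _ _) (hd0 _ _)
  have hmeas : ∀ i, AEMeasurable (fun y => ENNReal.ofReal (e i y)) μ := fun i =>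
    (he i).continuous.measurable.ennreal_ofReal.aemeasurable
  have hint : ∫⁻ y, ∑' i, ENNReal.ofReal (e i y) ∂μ ≠ ∞ := by
    rw [lintegral_tsum hmeas]
    have : ∀ i, ∫⁻ y, ENNReal.ofReal (e i y) ∂μ =
        ENNReal.ofReal (realConv μ (γ i.1) (d i.2) x) := fun i =>
      (ofReal_integral_eq_lintegral_ofReal (he i).integrable
        (Eventually.of_forall (he0 i))).symm
    simp_rw [this]
    exact hx.tsum_ofReal_ne_top
  have hB : AEMeasurable (fun y => ∑' i, ENNReal.ofReal (e i y)) μ := AEMeasurable.tsum hmeas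
  refine ⟨_, integrable_toReal_of_lintegral_ne_top hB hint, ?_⟩
  filter_upwards [ae_lt_top' hB hint] with y hy n
  have h1 : (∑ k ∈ Finset.range n, γ k y) * (∑ k ∈ Finset.range n, d k (y⁻¹ * x)) =
      ∑ i ∈ Finset.range n ×ˢ Finset.range n, e i y := by
    rw [Finset.sum_mul_sum, Finset.sum_product]
  rw [h1, ← ENNReal.ofReal_le_iff_le_toReal hy.ne, ENNReal.ofReal_sum_of_nonneg fun i _ => he0 i y]
  exact ENNReal.sum_le_tsum _

theorem ENNReal.le_mul_of_forall_pos {a b c : ℝ≥0∞} (ha : a ≠ ∞) (hb : b ≠ ∞)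
    (h : ∀ ε : ℝ≥0∞, ε ≠ 0 → ε ≠ ∞ → c ≤ (a + ε) * (b + ε)) : c ≤ a * b := by
  lift a to NNReal using ha
  lift b to NNReal using hb
  have ht : Tendsto (fun n : ℕ => (((a + 1 / ((n : NNReal) + 1)) * (b + 1 / ((n : NNReal) + 1)) :
      NNReal) : ℝ≥0∞)) atTop (𝓝 ((a * b : NNReal) : ℝ≥0∞)) := by
    rw [ENNReal.tendsto_coe]
    have h0 : Tendsto (fun n : ℕ => 1 / ((n : NNReal) + 1)) atTop (𝓝 0) :=
      tendsto_one_div_add_atTop_nhds_zero_nat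
    simpa using (h0.const_add a).mul (h0.const_add b)
  rw [← ENNReal.coe_mul]
  refine ge_of_tendsto' ht fun n => ?_
  have := h ((1 / ((n : NNReal) + 1) : NNReal) : ℝ≥0∞) (by simp) ENNReal.coe_ne_top
  push_cast at this ⊢
  exact this

/-- Young's inequality `‖g * f‖ₚ ≤ ‖g‖ₚ ‖f‖₁` on a unimodular group. -/
theorem groupConv_young [LocallyCompactSpace G] [μ.Regular] {p : ℝ≥0∞} (hp1 : 1 ≤ p) (hp : p ≠ ∞)
    {g f : G → ℂ} (hg : MemLp g p μ) (hf : MemLp f 1 μ) :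
    GroupConvExists μ g f ∧ MemLp (groupConv μ g f) p μ ∧
      eLpNorm (groupConv μ g f) p μ ≤ eLpNorm g p μ * eLpNorm f 1 μ := by
  -- `μ` need not be σ-finite, so instead of Tonelli both functions are approximated in `C₀₀(G)`.
  -- The double series of convolved increments converges almost everywhere and dominates the
  -- integrands; the loss `ε` is removed at the end.
  have key : ∀ ε : ℝ≥0∞, ε ≠ 0 → ε ≠ ∞ → GroupConvExists μ g f ∧
      AEStronglyMeasurable (groupConv μ g f) μ ∧
      eLpNorm (groupConv μ g f) p μ ≤ (eLpNorm g p μ + ε) * (eLpNorm f 1 μ + ε) := by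
    intro ε hε hε'
    obtain ⟨Ψ, γ, hΨ, hΨn, hΨt, hγ, hγ0, hγs, hΨγ⟩ := hg.exists_approx hp1 hp hε hε'
    obtain ⟨Φ, d, hΦ, hΦn, hΦt, hd, hd0, hds, hΦd⟩ :=
      hf.exists_approx le_rfl ENNReal.one_ne_top hε hε'
    have hsum : ∀ᵐ x ∂μ, Summable fun i : ℕ × ℕ => realConv μ (γ i.1) (d i.2) x := by
      have h1 : ∑' i : ℕ × ℕ, eLpNorm (realConv μ (γ i.1) (d i.2)) p μ ≠ ∞ := by
        refine ne_top_of_le_ne_top (ENNReal.mul_ne_top hγs hds) ?_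
        rw [← ENNReal.tsum_mul_right]
        simp_rw [← ENNReal.tsum_mul_left]
        rw [← ENNReal.tsum_prod (f := fun n k => eLpNorm (γ n) p μ * eLpNorm (d k) 1 μ)]
        exact ENNReal.tsum_le_tsum fun i =>
          eLpNorm_realConv_le (hγ i.1) (hd i.2) (hγ0 _) (hd0 _) hp1 hp
      filter_upwards [summable_norm_of_tsum_eLpNorm_ne_top hp1
        (fun i : ℕ × ℕ => ((hγ i.1).realConv (hd i.2)).continuous.aestronglyMeasurable) h1]
        with x hx using hx.of_norm
    have hlim : ∀ᵐ x ∂μ, GroupConvExistsAt μ g f x ∧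
        Tendsto (fun n => groupConv μ (Ψ n) (Φ n) x) atTop (𝓝 (groupConv μ g f x)) := by
      filter_upwards [hsum] with x hx
      obtain ⟨b, hbi, hb⟩ := exists_integrable_bound hγ hd hγ0 hd0 hx
      have hmeas : ∀ n, AEStronglyMeasurable (fun y => Ψ n y * Φ n (y⁻¹ * x)) μ := fun n =>
        ((hΨ n).1.mul ((hΦ n).1.comp (by fun_prop))).aestronglyMeasurable
      have hbd : ∀ᵐ y ∂μ, ∀ n, ‖Ψ n y * Φ n (y⁻¹ * x)‖ ≤ b y := by
        filter_upwards [hb] with y hy n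
        rw [norm_mul]
        refine le_trans ?_ (hy (n + 1))
        exact mul_le_mul (hΨγ n y) (hΦd n _) (norm_nonneg _)
          (Finset.sum_nonneg fun k _ => hγ0 k y)
      have ht : ∀ᵐ y ∂μ, Tendsto (fun n => Ψ n y * Φ n (y⁻¹ * x)) atTop
          (𝓝 (g y * f (y⁻¹ * x))) := by
        filter_upwards [hΨt, (quasiMeasurePreserving_inv_mul x).ae hΦt] with y h1 h2
        exact h1.mul h2
      refine ⟨hbi.mono' (aestronglyMeasurable_of_tendsto_ae atTop hmeas ht) ?_, ?_⟩
      · filter_upwards [hbd, ht] with y h1 h2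
        exact le_of_tendsto' h2.norm h1
      · exact tendsto_integral_of_dominated_convergence b hmeas hbi
          (fun n => hbd.mono fun y hy => hy n) ht
    have hcm : ∀ n, AEStronglyMeasurable (groupConv μ (Ψ n) (Φ n)) μ := fun n =>
      (continuous_groupConv (hΨ n).1 (hΨ n).2 (hΦ n).1).aestronglyMeasurable
    refine ⟨hlim.mono fun x hx => hx.1,
      aestronglyMeasurable_of_tendsto_ae atTop hcm (hlim.mono fun x hx => hx.2), ?_⟩
    refine Lp.eLpNorm_le_of_ae_tendsto (Eventually.of_forall fun n => ?_) hcm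
      (hlim.mono fun x hx => hx.2)
    exact (eLpNorm_groupConv_le_of_hasCompactSupport (hΨ n).1 (hΨ n).2 (hΦ n).1 (hΦ n).2
      hp1 hp).trans (mul_le_mul' (hΨn n) (hΦn n))
  have hle := ENNReal.le_mul_of_forall_pos hg.2.ne hf.2.ne fun ε h h' => (key ε h h').2.2
  obtain ⟨h1, h2, -⟩ := key 1 one_ne_zero ENNReal.one_ne_top
  exact ⟨h1, ⟨h2, hle.trans_lt (ENNReal.mul_lt_top hg.2 hf.2)⟩, hle⟩

end Young

/-- A regular Haar measure that is also right invariant is invariant under inversion. -/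
theorem isInvInvariant_of_isMulRightInvariant {G : Type*} [Group G] [TopologicalSpace G]
    [IsTopologicalGroup G] [LocallyCompactSpace G] [MeasurableSpace G] [BorelSpace G]
    (μ : Measure G) [μ.IsHaarMeasure] [μ.Regular] [μ.IsMulRightInvariant] :
    μ.IsInvInvariant := by
  constructor
  -- Right invariance of `μ` makes `μ.inv` left invariant, hence a multiple `c` of `μ`; inverting
  -- twice forces `c ^ 2 = 1`.
  let c : ℝ≥0∞ := Measure.haarScalarFactor μ.inv μ
  have hc : μ.inv = c • μ := Measure.isMulLeftInvariant_eq_smul_of_regular μ.inv μ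
  have : Measure.map Inv.inv (Measure.map Inv.inv μ) = c ^ 2 • μ := by
    rw [← Measure.inv_def μ, hc, Measure.map_smul, ← Measure.inv_def μ, hc, smul_smul, pow_two]
  have μeq : μ = c ^ 2 • μ := by
    rw [Measure.map_map continuous_inv.measurable continuous_inv.measurable] at this
    simpa only [inv_involutive, Function.Involutive.comp_self, Measure.map_id]
  have K : TopologicalSpace.PositiveCompacts G := Classical.arbitrary _
  have h2 : c ^ 2 * μ K = 1 ^ 2 * μ K := by
    conv_rhs => rw [μeq]
    simp
  have h3 : c ^ 2 = 1 ^ 2 := (ENNReal.mul_left_inj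
    (Measure.measure_pos_of_nonempty_interior _ K.interior_nonempty).ne' K.isCompact.measure_lt_top.ne).1 h2
  have h4 : c = 1 := (ENNReal.pow_right_strictMono two_ne_zero).injective h3
  rw [hc, h4, one_smul]

/-! ### Tempered functions: inclusions between the spaces and integrability of the nonnegative ones.
-/

section Tempered

variable {G : Type*} [Group G] [TopologicalSpace G] [IsTopologicalGroup G] [T2Space G]
  [LocallyCompactSpace G] [MeasurableSpace G] [BorelSpace G] {μ : Measure G} {p : ℝ≥0∞}

theorem IsCc.ofReal {g : G → ℝ} (hg : IsCc g) :
    Continuous (fun x => (g x : ℂ)) ∧ HasCompactSupport fun x => (g x : ℂ) :=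
  ⟨Complex.continuous_ofReal.comp hg.continuous,
    hg.compact.comp_left (g := fun r : ℝ => (r : ℂ)) Complex.ofReal_zero⟩

theorem eLpNorm_complex_ofReal (g : G → ℝ) : eLpNorm (fun x => (g x : ℂ)) p μ = eLpNorm g p μ :=
  eLpNorm_congr_norm_ae (Eventually.of_forall fun x => Complex.norm_real (g x))

theorem groupConv_ofReal (f g : G → ℝ) (x : G) :
    groupConv μ (fun y => (f y : ℂ)) (fun y => (g y : ℂ)) x = (realConv μ f g x : ℂ) := by
  simp only [groupConv, realConv, ← Complex.ofReal_mul]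
  exact integral_ofReal

theorem groupConv_congr_left {g g' : G → ℂ} (h : g =ᵐ[μ] g') (f : G → ℂ) :
    groupConv μ g f = groupConv μ g' f := by
  ext x
  refine integral_congr_ae ?_
  filter_upwards [h] with y hy
  rw [hy]

theorem groupConv_const_mul_left (c : ℂ) (g f : G → ℂ) :
    groupConv μ (fun y => c * g y) f = c • groupConv μ g f := by
  ext x
  simp only [groupConv, mul_assoc, Pi.smul_apply, smul_eq_mul]
  exact integral_const_mul _ _

theorem eLpNorm_groupConv_le_temperedNorm [IsFiniteMeasureOnCompacts μ] {g : G → ℂ}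
    (hg : Continuous g) (hgs : HasCompactSupport g) (hp0 : p ≠ 0) (f : G → ℂ) :
    eLpNorm (groupConv μ g f) p μ ≤ temperedNorm p μ f * eLpNorm g p μ := by
  have hgm : MemLp g p μ := hg.memLp_of_hasCompactSupport hgs
  by_cases h0 : eLpNorm g p μ = 0
  -- `g` cannot be normalized here, and the right side is `0` even if the tempered norm is infinite.
  · rw [groupConv_congr_left ((eLpNorm_eq_zero_iff hgm.1 hp0).1 h0)]
    have : groupConv μ 0 f = 0 := by
      ext x
      simp [groupConv]
    simp [this]
  set a := (eLpNorm g p μ).toReal with ha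
  have ha0 : 0 < a := ENNReal.toReal_pos h0 hgm.2.ne
  have hae : eLpNorm g p μ = ENNReal.ofReal a := (ENNReal.ofReal_toReal hgm.2.ne).symm
  let g' : G → ℂ := fun y => (a⁻¹ : ℂ) * g y
  have hg'n : eLpNorm g' p μ ≤ 1 := by
    have : g' = (a⁻¹ : ℂ) • g := rfl
    rw [this, eLpNorm_const_smul, hae, ← ofReal_norm, norm_inv, Complex.norm_real,
      Real.norm_of_nonneg ha0.le, ← ENNReal.ofReal_mul (by positivity), inv_mul_cancel₀ ha0.ne',
      ENNReal.ofReal_one]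
  have hle : eLpNorm (groupConv μ g' f) p μ ≤ temperedNorm p μ f :=
    le_iSup₂_of_le g' (continuous_const.mul hg) <| le_iSup₂_of_le hgs.mul_left hg'n le_rfl
  have hgg' : groupConv μ g f = (a : ℂ) • groupConv μ g' f := by
    rw [groupConv_const_mul_left, smul_smul, mul_inv_cancel₀ (by exact_mod_cast ha0.ne'), one_smul]
  rw [hgg', eLpNorm_const_smul, hae, ← ofReal_norm, Complex.norm_real,
    Real.norm_of_nonneg ha0.le, mul_comm]
  gcongr

theorem temperedNorm_le_bigTemperedNorm [IsFiniteMeasureOnCompacts μ] (f : G → ℂ) :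
    temperedNorm p μ f ≤ bigTemperedNorm p μ f := by
  refine iSup₂_le fun g hg => iSup₂_le fun hgs hgn => ?_
  have hgm : MemLp g p μ := hg.memLp_of_hasCompactSupport hgs
  have hae := hgm.coeFn_toLp
  rw [← groupConv_congr_left hae]
  refine le_iSup₂_of_le hgm.toLp ?_ le_rfl
  rwa [eLpNorm_congr_ae hae]

variable [μ.IsHaarMeasure] [μ.Regular] [μ.IsInvInvariant] [μ.IsMulRightInvariant]

theorem mem_LTSpace_of_memLp_one (hp1 : 1 ≤ p) (hp : p ≠ ∞) {f : Lp ℂ p μ} (hf : MemLp f 1 μ) :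
    f ∈ LTSpace p μ := by
  refine ⟨fun g => ?_, ?_⟩
  · have := groupConv_young hp1 hp (Lp.memLp g) hf
    exact ⟨this.1, this.2.1⟩
  · refine lt_of_le_of_lt (iSup₂_le fun g hg => ?_) hf.2
    refine (groupConv_young hp1 hp (Lp.memLp g) hf).2.2.trans ?_
    exact mul_le_of_le_one_left' hg

theorem groupConvExistsAt_of_hasCompactSupport (hp1 : 1 ≤ p) {g f : G → ℂ} (hg : Continuous g)
    (hgs : HasCompactSupport g) (hf : MemLp f p μ) (x : G) : GroupConvExistsAt μ g f x := by
  have h1 : MemLp (fun y => f (y⁻¹ * x)) p μ := hf.comp_measurePreserving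
    ((measurePreserving_mul_right μ x).comp (Measure.measurePreserving_inv μ))
  exact (h1.locallyIntegrable hp1).integrable_smul_left_of_hasCompactSupport hg hgs

/-- Convolving with a nonnegative function is monotone under restriction to a subset. -/
theorem norm_groupConv_indicator_le (hp1 : 1 ≤ p) {g : G → ℝ} (hg : IsCc g)
    (hg0 : ∀ x, 0 ≤ g x) {f : G → ℂ} (hf : MemLp f p μ)
    (hf0 : ∀ᵐ x ∂μ, 0 ≤ (f x).re ∧ (f x).im = 0) (s : Set G) (x : G) :
    ‖groupConv μ (fun y => (g y : ℂ)) (s.indicator f) x‖ ≤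
      ‖groupConv μ (fun y => (g y : ℂ)) f x‖ := by
  have hi : Integrable (fun y => (g y : ℂ) * f (y⁻¹ * x)) μ :=
    groupConvExistsAt_of_hasCompactSupport hp1 hg.ofReal.1 hg.ofReal.2 hf x
  -- Nonnegativity of both factors rules out cancellation; this is why the result concerns positive
  -- parts only.
  have heq : groupConv μ (fun y => (g y : ℂ)) f x =
      ((∫ y, ‖(g y : ℂ) * f (y⁻¹ * x)‖ ∂μ : ℝ) : ℂ) := by
    rw [groupConv, ← integral_complex_ofReal]
    refine integral_congr_ae ?_
    filter_upwards [(quasiMeasurePreserving_inv_mul x).ae hf0] with y hy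
    have h1 : f (y⁻¹ * x) = ((f (y⁻¹ * x)).re : ℂ) := Complex.ext rfl (by simp [hy.2])
    rw [h1, ← Complex.ofReal_mul, Complex.norm_real,
      Real.norm_of_nonneg (mul_nonneg (hg0 y) hy.1)]
  rw [heq, Complex.norm_real, Real.norm_of_nonneg (integral_nonneg fun y => norm_nonneg _)]
  refine norm_integral_le_of_norm_le hi.norm (Eventually.of_forall fun y => ?_)
  rw [norm_mul, norm_mul]
  exact mul_le_mul_of_nonneg_left (norm_indicator_le_norm_self f _) (norm_nonneg _)

/-- On an amenable group, an integrable piece of a nonnegative tempered function has norm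
controlled by the tempered norm. -/
theorem IsAmenableGroup.eLpNorm_indicator_le (hG : IsAmenableGroup G) (hp1 : 1 ≤ p) (hp2 : p ≤ 2)
    {f : G → ℂ} (hf : MemLp f p μ) (hf0 : ∀ᵐ x ∂μ, 0 ≤ (f x).re ∧ (f x).im = 0)
    (hft : temperedNorm p μ f < ∞) {s : Set G} (hs : MemLp (s.indicator f) 1 μ) :
    eLpNorm (s.indicator f) 1 μ ≤ temperedNorm p μ f + 1 + 1 := by
  have hp : p ≠ ∞ := (hp2.trans_lt (by simp)).ne
  have hp0 : p ≠ 0 := (zero_lt_one.trans_le hp1).ne'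
  have hpr1 : 1 ≤ p.toReal := by
    simpa using (ENNReal.toReal_le_toReal ENNReal.one_ne_top hp).2 hp1
  have hpr2 : p.toReal ≤ 2 := by
    simpa using (ENNReal.toReal_le_toReal hp (by simp)).2 hp2
  have hpr0 : 0 < p.toReal := by linarith
  set h := s.indicator f with hh
  obtain ⟨φ, hφd, hφc, hφm, hφs⟩ :=
    hs.exists_hasCompactSupport_eLpNorm_sub_le_of_t2 ENNReal.one_ne_top one_ne_zero
  -- The map `z ↦ max (re z) 0` is 1-Lipschitz and fixes the values of `h`, so `v` is as close to
  -- `h` as `φ` is.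
  let v : G → ℝ := fun x => max (φ x).re 0
  have hv : IsCc v := ⟨(Complex.continuous_re.comp hφc).max continuous_const,
    hφs.comp_left (g := fun z : ℂ => max z.re 0) (by simp)⟩
  have hv0 : ∀ x, 0 ≤ v x := fun x => le_max_right _ _
  have hvm : MemLp (fun x => (v x : ℂ)) 1 μ :=
    hv.ofReal.1.memLp_of_hasCompactSupport hv.ofReal.2
  have hvd : eLpNorm (fun x => (v x : ℂ) - h x) 1 μ ≤ 1 := by
    refine (eLpNorm_mono_ae ?_).trans hφd
    filter_upwards [hf0] with x hx
    have h1 : h x = ((h x).re : ℂ) ∧ 0 ≤ (h x).re := by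
      by_cases hxs : x ∈ s
      · rw [hh, indicator_of_mem hxs]
        exact ⟨Complex.ext rfl (by simp [hx.2]), hx.1⟩
      · rw [hh, indicator_of_notMem hxs]
        simp
    rw [h1.1, ← Complex.ofReal_sub, Complex.norm_real, Pi.sub_apply, norm_sub_rev]
    refine le_trans ?_ (Complex.abs_re_le_norm _)
    rw [Complex.sub_re]
    have h2 : max (h x).re 0 = (h x).re := max_eq_left h1.2
    have h3 := abs_max_sub_max_le_abs (φ x).re (h x).re 0
    rw [h2, abs_sub_comm (φ x).re] at h3
    rw [Real.norm_eq_abs, abs_sub_comm]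
    exact h3
  -- Convolution by `h` costs the tempered norm, and by `v - h` at most `1` by Young. The second `1`
  -- in the conclusion is spent returning from `v` to `h`.
  set C := (temperedNorm p μ f + 1).toReal with hC
  have hCne : temperedNorm p μ f + 1 ≠ ∞ := by simp [hft.ne]
  have hC0 : 0 < C := ENNReal.toReal_pos (by simp) hCne
  have hCe : temperedNorm p μ f + 1 = ENNReal.ofReal C := (ENNReal.ofReal_toReal hCne).symm
  have hbound : ∀ g, IsCc g → (∀ x, 0 ≤ g x) →
      ∫ x, realConv μ g v x ^ p.toReal ∂μ ≤ C ^ p.toReal * ∫ x, g x ^ p.toReal ∂μ := by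
    intro g hg hg0
    have hgm : MemLp (fun x => (g x : ℂ)) p μ :=
      hg.ofReal.1.memLp_of_hasCompactSupport hg.ofReal.2
    have hy1 := groupConv_young hp1 hp hgm hs
    have hy2 := groupConv_young hp1 hp hgm (hvm.sub hs)
    have hsplit : groupConv μ (fun y => (g y : ℂ)) (fun y => (v y : ℂ)) =ᵐ[μ]
        groupConv μ (fun y => (g y : ℂ)) h +
          groupConv μ (fun y => (g y : ℂ)) ((fun y => (v y : ℂ)) - h) := by
      filter_upwards [hy1.1, hy2.1] with x h1 h2
      rw [Pi.add_apply, groupConv, groupConv, groupConv, ← integral_add h1 h2]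
      congr 1; ext y
      simp only [Pi.sub_apply]
      ring
    have hle : eLpNorm (realConv μ g v) p μ ≤ ENNReal.ofReal C * eLpNorm g p μ := by
      rw [← eLpNorm_complex_ofReal (realConv μ g v), ← hCe, ← eLpNorm_complex_ofReal g, add_mul, one_mul]
      simp_rw [← groupConv_ofReal]
      rw [eLpNorm_congr_ae hsplit]
      refine (eLpNorm_add_le hy1.2.1.1 hy2.2.1.1 hp1).trans (add_le_add ?_ ?_)
      · exact (eLpNorm_mono fun x => norm_groupConv_indicator_le hp1 hg hg0 hf hf0 s x).trans
          (eLpNorm_groupConv_le_temperedNorm hg.ofReal.1 hg.ofReal.2 hp0 f)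
      · exact hy2.2.2.trans (mul_le_of_le_one_right' hvd)
    have hA : 0 ≤ ∫ x, realConv μ g v x ^ p.toReal ∂μ :=
      integral_nonneg fun x => Real.rpow_nonneg (realConv_nonneg hg0 hv0 x) _
    have hB : 0 ≤ ∫ x, g x ^ p.toReal ∂μ := integral_nonneg fun x => Real.rpow_nonneg (hg0 x) _
    rw [(hg.realConv hv).eLpNorm_eq (realConv_nonneg hg0 hv0) hp0 hp, hg.eLpNorm_eq hg0 hp0 hp,
      ← ENNReal.ofReal_mul hC0.le, ENNReal.ofReal_le_ofReal_iff (by positivity)] at hle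
    have h2 := Real.rpow_le_rpow (by positivity) hle hpr0.le
    rwa [Real.mul_rpow hC0.le (by positivity), ← Real.rpow_mul hA, ← Real.rpow_mul hB,
      inv_mul_cancel₀ hpr0.ne', Real.rpow_one, Real.rpow_one] at h2
  have hvC := hG.integral_le_of_convBound hv hv0 hpr1 hpr2 hC0 hbound
  have hv1 : eLpNorm (fun x => (v x : ℂ)) 1 μ ≤ temperedNorm p μ f + 1 := by
    rw [eLpNorm_complex_ofReal, hv.eLpNorm_eq hv0 one_ne_zero ENNReal.one_ne_top, hCe]
    simpa using ENNReal.ofReal_le_ofReal hvC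
  have hsub : h = (fun x => (v x : ℂ)) - ((fun x => (v x : ℂ)) - h) := by simp
  rw [hsub]
  exact (eLpNorm_sub_le hvm.1 (hvm.sub hs).1 le_rfl).trans (add_le_add hv1 hvd)

theorem IsAmenableGroup.memLp_one_of_tempered (hG : IsAmenableGroup G) (hp1 : 1 ≤ p) (hp2 : p ≤ 2)
    {f : G → ℂ} (hfm : StronglyMeasurable f) (hf : MemLp f p μ)
    (hf0 : ∀ᵐ x ∂μ, 0 ≤ (f x).re ∧ (f x).im = 0) (hft : temperedNorm p μ f < ∞) : MemLp f 1 μ := by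
  have hp : p ≠ ∞ := (hp2.trans_lt (by simp)).ne
  have hp0 : p ≠ 0 := (zero_lt_one.trans_le hp1).ne'
  -- By Chebyshev these level sets have finite measure, so the truncations are in `L¹`; they
  -- converge pointwise to `f`.
  let s : ℕ → Set G := fun n => {x | 1 / ((n : NNReal) + 1) ≤ ‖f x‖₊}
  have hsm : ∀ n, MeasurableSet (s n) := fun n =>
    measurableSet_le measurable_const hfm.nnnorm.measurable
  have hs1 : ∀ n, MemLp ((s n).indicator f) 1 μ := fun n =>
    MemLp.mono_exponent_of_measure_support_ne_top (hf.indicator (hsm n))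
      (fun x hx => indicator_of_notMem hx f)
      (hf.meas_ge_lt_top hp0 hp (by positivity)).ne hp1
  have hlim : ∀ x, Tendsto (fun n => (s n).indicator f x) atTop (𝓝 (f x)) := by
    intro x
    by_cases hx : f x = 0
    · have : ∀ n, (s n).indicator f x = f x := fun n => by
        by_cases h : x ∈ s n <;> simp [h, hx]
      simp [this]
    · have h0 : Tendsto (fun n : ℕ => 1 / ((n : NNReal) + 1)) atTop (𝓝 0) :=
        tendsto_one_div_add_atTop_nhds_zero_nat
      refine tendsto_const_nhds.congr' ?_
      filter_upwards [h0.eventually_lt_const (nnnorm_pos.2 hx)] with n hn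
      exact (indicator_of_mem (show x ∈ s n from hn.le) f).symm
  refine ⟨hf.1, lt_of_le_of_lt (Lp.eLpNorm_le_of_ae_tendsto (u := atTop)
    (Eventually.of_forall fun n => hG.eLpNorm_indicator_le hp1 hp2 hf hf0 hft (hs1 n))
    (fun n => (hs1 n).1) (Eventually.of_forall hlim)) ?_⟩
  simp [hft]

end Tempered

/-! ### The main theorem, as a cycle of three inclusions. -/

theorem corollaryc1 {G : Type*} [Group G] [TopologicalSpace G] [IsTopologicalGroup G]
    [LocallyCompactSpace G] [T2Space G] [MeasurableSpace G] [BorelSpace G]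
    (μ : Measure G) [μ.IsHaarMeasure] [μ.Regular]
    -- `G` is unimodular: the left Haar measure is also right invariant
    [μ.IsMulRightInvariant]
    (hG : IsAmenableGroup G) (p : ℝ≥0∞) (hp1 : 1 < p) (hp2 : p ≤ 2) :
    positivePart (L1InterLp p μ) = positivePart (LtSpace p μ) ∧
      positivePart (LtSpace p μ) = positivePart (LTSpace p μ) := by
  have hp : p ≠ ∞ := (hp2.trans_lt (by simp)).ne
  have hinv : μ.IsInvInvariant := isInvInvariant_of_isMulRightInvariant μ
  have h12 : L1InterLp p μ ⊆ LTSpace p μ := fun f hf => mem_LTSpace_of_memLp_one hp1.le hp hf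
  have h23 : LTSpace p μ ⊆ LtSpace p μ := fun f hf =>
    (temperedNorm_le_bigTemperedNorm (f : G → ℂ)).trans_lt hf.2
  have h31 : positivePart (LtSpace p μ) ⊆ positivePart (L1InterLp p μ) := fun f hf =>
    ⟨hG.memLp_one_of_tempered hp1.le hp2 (Lp.stronglyMeasurable f) (Lp.memLp f) hf.2 hf.1, hf.2⟩
  exact ⟨Subset.antisymm (fun f hf => ⟨h23 (h12 hf.1), hf.2⟩) h31,
    Subset.antisymm (fun f hf => ⟨h12 (h31 hf).1, hf.2⟩) fun f hf => ⟨h23 hf.1, hf.2⟩⟩
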